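/- Let $\mathcal H$ be a complex Hilbert space of arbitrary (possibly infinite) dimension and let $K$ be an arbitrary (possibly infinite) index set. An ensemble $\mathcal E=\{\rho_k\}_{k\in K}$ consists of positive semidefinite trace class operators on $\mathcal H$ with $\sum_k \operatorname{Tr}\rho_k=1$. A POVM is a family $M=\{M_k\}_{k\in K}$ of bounded positive semidefinite operators with $\sum_k M_k=1$ (strong convergence). Put $L_M=\sum_k M_k\rho_k$, $P_{\mathrm{succ}}(M)=\operatorname{Tr}L_M$, and $\operatorname{Re}A=(A+A^\dagger)/2$; a POVM is called optimal if it maximizes $P_{\mathrm{succ}}$ over all POVMs. For self-adjoint $A$ let $[A]_+$ be its positive part and $\chi_+(A)$ its spectral projection for $(0,\infty)$. An iterate of a POVM $M$ is a POVM $M^+$ obtained as follows: choose $\ell\in K$ that maximizes $\alpha=\operatorname{Tr}[\rho_\ell-\operatorname{Re}L_M]_+$, put $X=\alpha\,\chi_+(\rho_\ell-\operatorname{Re}L_M)$, and let $$M_k^+=(1-X)M_k(1-X)+\delta_{k\ell}(2X-X^2).$$ An iterative series is a sequence of POVMs $M^{(0)},M^{(1)},\dots$ in which every $M^{(n+1)}$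 is an iterate of $M^{(n)}$. For $p\ge 0$ let $\dim_p(\mathcal E)\in\{0,1,2,\dots,\infty\}$ be the minimum dimension of a closed subspace $\Lambda\subseteq\mathcal H$ with $\sum_k\|(1-\Pi_\Lambda)\rho_k\|_1\le p$, where $\Pi_\Lambda$ is the orthogonal projection onto $\Lambda$ and $\|\cdot\|_1$ is the trace norm. Theorem. An optimal POVM exists, and for every POVM $M^{(0)}$ there is an iterative series starting from $M^{(0)}$. For every such series and every optimal POVM $M^{\mathrm{opt}}$, $$\lim_{n\to\infty}P_{\mathrm{succ}}(M^{(n)})=P_{\mathrm{succ}}(M^{\mathrm{opt}}).$$ Moreover, for every $\varepsilon>0$ the number $s_\varepsilon=\sup_{p\in[0,\varepsilon/4]}\frac{\varepsilon-4p}{\dim_p(\mathcal E)}\in[0,\infty]$ (with the conventions $a/\infty=0$, $a/0=\infty$ for $a>0$, and $0/0=0$) is positive, and for every real $\Delta$ with $0<\Delta\le s_\varepsilon$, $$P_{\mathrm{succ}}(M^{(n)})\ \ge\ P_{\mathrm{succ}}(M^{\mathrm{opt}})-\varepsilon\qquad\text{for all integers } n\ge N=\Delta^{-2}.$$ -/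

import Mathlib

open Filter Topology
open scoped ENNReal InnerProductSpace

noncomputable section

namespace QuantumDetection

variable {K H : Type*} [NormedAddCommGroup H] [InnerProductSpace ℂ H] [CompleteSpace H]

/-- A set of vectors indexing a Hilbert (that is, complete orthonormal) basis of `H`. -/
def basisSet (H : Type*) [NormedAddCommGroup H] [InnerProductSpace ℂ H] [CompleteSpace H] :
    Set H :=
  (exists_hilbertBasis ℂ H).choose

/-- A fixed Hilbert basis of `H`, used to compute traces.  The trace norm of every bounded operator
and the trace of every trace class operator do not depend on this choice. -/
def basis (H : Type*) [NormedAddCommGroup H] [InnerProductSpace ℂ H] [CompleteSpace H] :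
    HilbertBasis (basisSet H) ℂ H :=
  (exists_hilbertBasis ℂ H).choose_spec.choose

/-- The trace norm `‖B‖₁ = Tr √(B† B)`, with the value `∞` when `B` is not trace class. -/
def traceNorm (B : H →L[ℂ] H) : ℝ≥0∞ :=
  ∑' i, ENNReal.ofReal (RCLike.re ⟪basis H i, CFC.sqrt (star B * B) (basis H i)⟫_ℂ)

/-- Trace class operators. -/
def IsTraceClass (B : H →L[ℂ] H) : Prop :=
  traceNorm B ≠ ∞

/-- The trace `Tr A = ∑ i, ⟪e i, A e i⟫` of a trace class operator. -/
def trace (A : H →L[ℂ] H) : ℂ :=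
  ∑' i, ⟪basis H i, A (basis H i)⟫_ℂ

/-- An ensemble `{ρ k}` of mixed quantum states: positive semidefinite trace class operators,
normalized by a-priori probability, `Tr (ρ k) = p k` with `∑ k, p k = 1`. -/
structure Ensemble (K H : Type*) [NormedAddCommGroup H] [InnerProductSpace ℂ H]
    [CompleteSpace H] where
  /-- the states `ρ k` -/
  op : K → H →L[ℂ] H
  isPositive : ∀ k, (op k).IsPositive
  isTraceClass : ∀ k, IsTraceClass (op k)
  hasSum_trace : HasSum (fun k => trace (op k)) 1

/-- A positive operator-valued measurement `{M k}`: positive semidefinite operators with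
`∑ k, M k = 1`, the sum converging in the strong operator topology. -/
structure POVM (K H : Type*) [NormedAddCommGroup H] [InnerProductSpace ℂ H]
    [CompleteSpace H] where
  /-- the effects `M k` -/
  op : K → H →L[ℂ] H
  isPositive : ∀ k, (op k).IsPositive
  hasSum_apply : ∀ x, HasSum (fun k => op k x) x

/-- The Lagrange operator `L = ∑ k, M k ρ k`.  The series converges absolutely, because
`‖M k ρ k‖ ≤ Tr (ρ k)`. -/
def lagrange (E : Ensemble K H) (M : POVM K H) : H →L[ℂ] H :=
  ∑' k, M.op k * E.op k

/-- The success probability `Tr L`, a complex number which is in fact real. -/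
def successProb (E : Ensemble K H) (M : POVM K H) : ℝ :=
  (trace (lagrange E M)).re

/-- `M` is an optimal measurement: it maximizes the success probability among all POVMs. -/
def IsOptimal (E : Ensemble K H) (M : POVM K H) : Prop :=
  ∀ M' : POVM K H, successProb E M' ≤ successProb E M

/-- The real part `Re A = (A + A†) / 2`. -/
def opRe (A : H →L[ℂ] H) : H →L[ℂ] H :=
  (2⁻¹ : ℂ) • (A + star A)

/-- The positive projection `χ₊ A` of a self-adjoint operator `A`, that is, its spectral projection
for `(0, ∞)`: the orthogonal projection onto the closure of the range of the positive part `A⁺`.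
If `A = ∑ λ j • Π j` is a spectral decomposition, it is the sum of the `Π j` with `0 < λ j`. -/
def positiveProjection (A : H →L[ℂ] H) : H →L[ℂ] H :=
  (A⁺).range.topologicalClosure.starProjection

/-- The operator `ρ l - Re L`. -/
def gap (E : Ensemble K H) (M : POVM K H) (l : K) : H →L[ℂ] H :=
  E.op l - opRe (lagrange E M)

/-- The number `Tr [ρ l - Re L]₊`. -/
def violation (E : Ensemble K H) (M : POVM K H) (l : K) : ℝ :=
  (trace (gap E M l)⁺).re

open scoped Classical in
/-- The Barnett-Croke modification
`M k (X, l) = (1 - X) M k (1 - X) + δ k l (2 X - X ^ 2)` of a measurement. -/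
def modification (M : POVM K H) (X : H →L[ℂ] H) (l k : K) : H →L[ℂ] H :=
  (1 - X) * M.op k * (1 - X) + if k = l then (2 : ℂ) • X - X ^ 2 else 0

/-- `M'` is an iterate of `M`: for some index `l` that maximizes `α = Tr [ρ l - Re L]₊`, it is the
Barnett-Croke modification of `M` with `X = α χ₊(ρ l - Re L)`. -/
def IsIterate (E : Ensemble K H) (M M' : POVM K H) : Prop :=
  ∃ l, (∀ j, violation E M j ≤ violation E M l) ∧
    ∀ k, M'.op k =
      modification M ((violation E M l : ℂ) • positiveProjection (gap E M l)) l k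

/-- `M 0, M 1, M 2, …` is an iterative series: each term is an iterate of the preceding one. -/
def IsIterativeSeries (E : Ensemble K H) (M : ℕ → POVM K H) : Prop :=
  ∀ n, IsIterate E (M n) (M (n + 1))

/-- The `p`-dimension of an ensemble: the minimal dimension (`∞` if infinite) of a closed subspace
`Λ` with `∑ k, ‖(1 - Π_Λ) ρ k‖₁ ≤ p`. -/
def pDim (E : Ensemble K H) (p : ℝ) : ℕ∞ :=
  ⨅ (Λ : Submodule ℂ H) (_ : Λ.HasOrthogonalProjection)
    (_ : ∑' k, traceNorm ((1 - Λ.starProjection) * E.op k) ≤ ENNReal.ofReal p),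
    Cardinal.toENat (Module.rank ℂ Λ)

/-- The bound `sup_{p ∈ [0, ε / 4]} (ε - 4 p) / dim_p`, computed in `[0, ∞]`. -/
def stepBound (E : Ensemble K H) (ε : ℝ) : ℝ≥0∞ :=
  ⨆ p ∈ Set.Icc (0 : ℝ) (ε / 4), ENNReal.ofReal (ε - 4 * p) / (pDim E p : ℝ≥0∞)

end QuantumDetection

end

open QuantumDetection

set_option linter.unusedSectionVars false

namespace QuantumDetection

variable {K H : Type*} [NormedAddCommGroup H] [InnerProductSpace ℂ H] [CompleteSpace H]

/-! ### Traces, cyclicity and nuclear representations -/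

section

/-! Let `a` be the largest violation of a POVM. Two estimates drive everything. Gain
(`IsIterate.exists_add_sq_le`): expanding the modification with `X = a P`, the terms linear in `X`
contribute `2 Tr X(ρ l - Re L) = 2 a²`, the term `-X²` costs at most `a² Tr (ρ l) ≤ a²`, and `X M X`
only helps. So one step gains at least `a²`. Gap (`successProb_sub_le`): every `ρ k - Re L` is at
most `a • 1`. Testing this against a competing POVM compressed to a finite-dimensional `Λ` costs `a
dim Λ`, plus an error of order `p` for compressing. So a gap above `ε` forces `a` to be at least
every quotient in `stepBound` (`stepBound_le`). Together, as long as the gap exceeds `ε`, each step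
gains `Δ²`. Success probabilities lie in `[0, 1]`, so this stops within `Δ⁻²` steps. Finite-rank
approximation makes `stepBound` positive, which gives the limit. An optimum exists by weak
compactness: mass may be lost in the limit of a maximizing sequence, and the deficit is assigned to
one outcome. Analytically, the vectors `√(ρ k) (e i)`, of total squared norm one, dominate all the
series indexed by pairs `(k, i)`. -/

/-- `A` has summable diagonal after multiplication by bounded operators on both sides, and its
trace is cyclic with respect to bounded factors. -/
def HasTrace (A : H →L[ℂ] H) : Prop :=
  ∀ B C : H →L[ℂ] H,
    HasSum (fun i => ⟪basis H i, (B * A * C) (basis H i)⟫_ℂ) (trace (C * B * A))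

namespace HasTrace

variable {A A' : H →L[ℂ] H}

theorem hasSum (h : HasTrace A) :
    HasSum (fun i => ⟪basis H i, A (basis H i)⟫_ℂ) (trace A) := by
  simpa using h 1 1

theorem trace_mul_comm (h : HasTrace A) (C : H →L[ℂ] H) : trace (A * C) = trace (C * A) := by
  simpa [trace] using (h 1 C).tsum_eq

theorem trace_add (h : HasTrace A) (h' : HasTrace A') : trace (A + A') = trace A + trace A' := by
  simpa [trace, inner_add_right] using (h.hasSum.add h'.hasSum).tsum_eq

theorem trace_sub (h : HasTrace A) (h' : HasTrace A') : trace (A - A') = trace A - trace A' := by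
  simpa [trace, inner_sub_right] using (h.hasSum.sub h'.hasSum).tsum_eq

theorem trace_smul (A : H →L[ℂ] H) (c : ℂ) : trace (c • A) = c * trace A := by
  simp [trace, tsum_mul_left]

theorem trace_adjoint (A : H →L[ℂ] H) : trace (star A) = star (trace A) := by
  simp only [trace, tsum_star]
  congr 1; ext i
  rw [ContinuousLinearMap.star_eq_adjoint, ContinuousLinearMap.adjoint_inner_right]
  simp

theorem mul_left (h : HasTrace A) (D : H →L[ℂ] H) : HasTrace (D * A) := by
  intro B C
  simpa only [mul_assoc] using h (B * D) C

theorem mul_right (h : HasTrace A) (D : H →L[ℂ] H) : HasTrace (A * D) := by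
  intro B C
  have h₁ := h B (D * C)
  have h₂ := (h.mul_left (C * B)).trace_mul_comm D
  simp only [mul_assoc] at h₁ h₂ ⊢
  rwa [h₂]

theorem add (h : HasTrace A) (h' : HasTrace A') : HasTrace (A + A') := by
  intro B C
  have := (h B C).add (h' B C)
  rw [← (h.mul_left (C * B)).trace_add (h'.mul_left (C * B))] at this
  simpa [mul_add, add_mul, inner_add_right] using this

theorem smul (h : HasTrace A) (c : ℂ) : HasTrace (c • A) := by
  intro B C
  have := (h B C).mul_left c
  rw [← trace_smul] at this
  simpa [inner_smul_right] using this

theorem neg (h : HasTrace A) : HasTrace (-A) := by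
  simpa using h.smul (-1)

theorem sub (h : HasTrace A) (h' : HasTrace A') : HasTrace (A - A') := by
  simpa [sub_eq_add_neg] using h.add h'.neg

theorem adjoint (h : HasTrace A) : HasTrace (star A) := by
  intro B C
  have h₁ := (h (star C) (star B)).star
  have h₂ := h.trace_mul_comm (star B * star C)
  rw [← h₂, ← trace_adjoint] at h₁
  convert h₁ using 1
  · ext i
    have : B * star A * C = star (star C * A * star B) := by simp [mul_assoc]
    -- The diagonal of an adjoint is the conjugate diagonal.
    rw [this, ContinuousLinearMap.star_eq_adjoint (star C * A * star B),
      ContinuousLinearMap.adjoint_inner_right]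
    simp
  · simp [mul_assoc]

/-- The trace of a product of two positive operators is nonnegative. -/
theorem trace_mul_nonneg (h : HasTrace A) (hA : 0 ≤ A) {X : H →L[ℂ] H} (hX : 0 ≤ X) :
    0 ≤ (trace (X * A)).re := by
  set S := CFC.sqrt X
  have hS : S * S = X := CFC.sqrt_mul_sqrt_self X
  have hSsa : star S = S := (CFC.sqrt_nonneg X).isSelfAdjoint
  have h₁ : trace (X * A) = trace (S * A * S) := by
    rw [(h.mul_left S).trace_mul_comm S, ← mul_assoc, hS]
  have h₂ : 0 ≤ S * A * S := by simpa [hSsa] using star_left_conjugate_nonneg hA S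
  rw [h₁]
  have h₃ := Complex.hasSum_re ((h.mul_left S).mul_right S).hasSum
  refine h₃.nonneg fun i => ?_
  exact ((ContinuousLinearMap.nonneg_iff_isPositive _).1 h₂).re_inner_nonneg_right _

theorem trace_nonneg (h : HasTrace A) (hA : 0 ≤ A) : 0 ≤ (trace A).re := by
  have := h.trace_mul_nonneg hA (X := 1) zero_le_one
  simpa using this

end HasTrace

/-- Cauchy-Schwarz and Bessel. The bound is uniform in `s`, which supplies the absolute convergence
needed to exchange sums in `hasSum_trace`. -/
theorem sum_norm_inner_mul_le {ι : Type*} (b : HilbertBasis ι ℂ H) (x y : H) (s : Finset ι) :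
    ∑ i ∈ s, ‖⟪b i, x⟫_ℂ * ⟪y, b i⟫_ℂ‖ ≤ ‖x‖ * ‖y‖ := by
  calc ∑ i ∈ s, ‖⟪b i, x⟫_ℂ * ⟪y, b i⟫_ℂ‖
      = ∑ i ∈ s, ‖⟪b i, x⟫_ℂ‖ * ‖⟪b i, y⟫_ℂ‖ := by
        refine Finset.sum_congr rfl fun i _ => ?_
        rw [norm_mul, norm_inner_symm y]
    _ ≤ √(∑ i ∈ s, ‖⟪b i, x⟫_ℂ‖ ^ 2) * √(∑ i ∈ s, ‖⟪b i, y⟫_ℂ‖ ^ 2) :=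
        Real.sum_mul_le_sqrt_mul_sqrt _ _ _
    _ ≤ ‖x‖ * ‖y‖ := by
        gcongr
        · exact Real.sqrt_le_left (norm_nonneg _) |>.2 (b.orthonormal.sum_inner_products_le x)
        · exact Real.sqrt_le_left (norm_nonneg _) |>.2 (b.orthonormal.sum_inner_products_le y)

/-- `A = ∑ i, |x i⟩⟨y i|` with `∑ i, ‖x i‖ ‖y i‖ < ∞`. -/
structure HasRankOneSum {ι : Type*} (A : H →L[ℂ] H) (x y : ι → H) : Prop where
  summable : Summable fun i => ‖x i‖ * ‖y i‖
  hasSum : ∀ u v, HasSum (fun i => ⟪v, x i⟫_ℂ * ⟪y i, u⟫_ℂ) ⟪v, A u⟫_ℂ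

namespace HasRankOneSum

variable {ι : Type*} {A : H →L[ℂ] H} {x y : ι → H}

theorem mul_left (h : HasRankOneSum A x y) (B : H →L[ℂ] H) :
    HasRankOneSum (B * A) (fun i => B (x i)) y where
  summable := by
    refine (h.summable.mul_left ‖B‖).of_nonneg_of_le (fun i => by positivity) fun i => ?_
    rw [← mul_assoc]
    gcongr
    exact B.le_opNorm _
  hasSum u v := by
    simpa [ContinuousLinearMap.adjoint_inner_left] using
      h.hasSum u (ContinuousLinearMap.adjoint B v)

theorem mul_right (h : HasRankOneSum A x y) (C : H →L[ℂ] H) :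
    HasRankOneSum (A * C) x (fun i => star C (y i)) where
  summable := by
    refine (h.summable.mul_left ‖star C‖).of_nonneg_of_le (fun i => by positivity) fun i => ?_
    rw [mul_left_comm]
    gcongr
    exact (star C).le_opNorm _
  hasSum u v := by
    simpa [ContinuousLinearMap.star_eq_adjoint, ContinuousLinearMap.adjoint_inner_left] using
      h.hasSum (C u) v

theorem summable_inner (h : HasRankOneSum A x y) : Summable fun i => ⟪y i, x i⟫_ℂ :=
  h.summable.of_norm_bounded fun i => by rw [mul_comm]; exact norm_inner_le_norm _ _

/-- Fubini for the double series over terms and basis vectors: summing over the basis first is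
Parseval, summing over the terms first gives the diagonal of `A`. -/
theorem hasSum_trace (h : HasRankOneSum A x y) :
    HasSum (fun b => ⟪basis H b, A (basis H b)⟫_ℂ) (∑' i, ⟪y i, x i⟫_ℂ) := by
  have hs : Summable fun p : ι × basisSet H =>
      ⟪basis H p.2, x p.1⟫_ℂ * ⟪y p.1, basis H p.2⟫_ℂ := by
    refine Summable.of_norm ((summable_prod_of_nonneg fun _ => norm_nonneg _).2 ⟨fun i => ?_, ?_⟩)
    · exact summable_of_sum_le (fun _ => norm_nonneg _)
        (sum_norm_inner_mul_le (basis H) (x i) (y i))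
    · refine h.summable.of_nonneg_of_le (fun i => tsum_nonneg fun _ => norm_nonneg _) fun i => ?_
      exact Real.tsum_le_of_sum_le (fun _ => norm_nonneg _)
        (sum_norm_inner_mul_le (basis H) (x i) (y i))
  have h₁ := hs.hasSum.prod_fiberwise fun i => by
    have := (basis H).hasSum_inner_mul_inner (y i) (x i)
    simpa only [mul_comm] using this
  rw [h₁.tsum_eq]
  have h₂ := (Equiv.prodComm (basisSet H) ι).hasSum_iff.2 hs.hasSum
  exact h₂.prod_fiberwise fun b => h.hasSum (basis H b) (basis H b)

theorem trace_eq (h : HasRankOneSum A x y) : trace A = ∑' i, ⟪y i, x i⟫_ℂ :=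
  h.hasSum_trace.tsum_eq

theorem hasSum_inner (h : HasRankOneSum A x y) : HasSum (fun i => ⟪y i, x i⟫_ℂ) (trace A) :=
  h.trace_eq ▸ h.summable_inner.hasSum

theorem hasTrace (h : HasRankOneSum A x y) : HasTrace A := by
  intro B C
  have h₁ := ((h.mul_left B).mul_right C).hasSum_trace
  rw [(h.mul_left (C * B)).trace_eq]
  simpa [ContinuousLinearMap.star_eq_adjoint, ContinuousLinearMap.adjoint_inner_left] using h₁

theorem norm_trace_mul_le (h : HasRankOneSum A x y) (B : H →L[ℂ] H) :
    ‖trace (B * A)‖ ≤ ‖B‖ * ∑' i, ‖x i‖ * ‖y i‖ := by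
  rw [(h.mul_left B).trace_eq, ← tsum_mul_left]
  refine tsum_of_norm_bounded (h.summable.mul_left _).hasSum fun i => ?_
  refine (norm_inner_le_norm _ _).trans ?_
  rw [mul_comm, ← mul_assoc]
  gcongr
  exact B.le_opNorm _

end HasRankOneSum

end

/-! ### Trace norm and polar factorization -/

section

/-- Douglas factorization. -/
theorem exists_eq_mul_of_norm_le {A B : H →L[ℂ] H} (h : ∀ x, ‖A x‖ ≤ ‖B x‖) :
    ∃ C : H →L[ℂ] H, A = C * B ∧ ‖C‖ ≤ 1 := by
  let R := (B.range).topologicalClosure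
  have hR : ∀ x, B x ∈ R := fun x =>
    Submodule.le_topologicalClosure _ (LinearMap.mem_range_self _ x)
  let e : H →ₗ[ℂ] R := (B : H →ₗ[ℂ] H).codRestrict R hR
  have he : DenseRange e := by
    intro y
    rw [Metric.mem_closure_iff]
    intro ε hε
    have hy : (y : H) ∈ closure ((B.range : Submodule ℂ H) : Set H) := y.2
    obtain ⟨_, ⟨x, rfl⟩, hx⟩ := Metric.mem_closure_iff.1 hy ε hε
    exact ⟨e x, ⟨x, rfl⟩, hx⟩
  have hbound : ∀ x, ‖(A : H →ₗ[ℂ] H) x‖ ≤ 1 * ‖e x‖ := fun x => by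
    rw [one_mul]; exact h x
  -- The assignment `B x ↦ A x` is well defined and contractive by `h`, so it extends from the dense
  -- range to all of `R`.
  let C₀ : R →L[ℂ] H := (A : H →ₗ[ℂ] H).extendOfNorm e
  refine ⟨C₀ ∘L R.orthogonalProjectionOnto, ?_, ?_⟩
  · ext x
    have h₁ : R.orthogonalProjectionOnto (B x) = e x :=
      Submodule.orthogonalProjectionOnto_mem_subspace_eq_self (e x)
    have h₂ : C₀ (e x) = A x := LinearMap.extendOfNorm_eq he ⟨1, hbound⟩ x
    simp [h₁, h₂]
  · refine ContinuousLinearMap.opNorm_le_bound _ zero_le_one fun x => ?_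
    refine (LinearMap.norm_extendOfNorm_apply_le he 1 hbound _).trans ?_
    gcongr
    exact R.norm_orthogonalProjectionOnto_apply_le x

theorem norm_sqrt_apply_sq {A : H →L[ℂ] H} (hA : 0 ≤ A) (x : H) :
    ‖CFC.sqrt A x‖ ^ 2 = RCLike.re ⟪x, A x⟫_ℂ := by
  have hS : CFC.sqrt A * CFC.sqrt A = A := CFC.sqrt_mul_sqrt_self A
  have hsa : ContinuousLinearMap.adjoint (CFC.sqrt A) = CFC.sqrt A :=
    (CFC.sqrt_nonneg A).isSelfAdjoint
  conv_rhs => rw [← hS]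
  rw [mul_apply_eq_comp, ← ContinuousLinearMap.adjoint_inner_left, hsa,
    inner_self_eq_norm_sq]

theorem hasRankOneSum_sqrt {A : H →L[ℂ] H} (hA : 0 ≤ A)
    (h : Summable fun i => ‖CFC.sqrt A (basis H i)‖ ^ 2) :
    HasRankOneSum A (fun i => CFC.sqrt A (basis H i)) (fun i => CFC.sqrt A (basis H i)) where
  summable := by simpa only [sq] using h
  hasSum u v := by
    have hS : CFC.sqrt A * CFC.sqrt A = A := CFC.sqrt_mul_sqrt_self A
    have hsa : ContinuousLinearMap.adjoint (CFC.sqrt A) = CFC.sqrt A :=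
      (CFC.sqrt_nonneg A).isSelfAdjoint
    have h₁ := (basis H).hasSum_inner_mul_inner (CFC.sqrt A v) (CFC.sqrt A u)
    have key : ∀ x y : H, ⟪CFC.sqrt A x, y⟫_ℂ = ⟪x, CFC.sqrt A y⟫_ℂ := fun x y => by
      conv_lhs => rw [← hsa, ContinuousLinearMap.adjoint_inner_left]
    have hA' : ⟪v, A u⟫_ℂ = ⟪v, CFC.sqrt A (CFC.sqrt A u)⟫_ℂ := by
      rw [← mul_apply_eq_comp, hS]
    rw [hA']
    simpa only [key] using h₁

/-- `√(B† B)` has the same pointwise norm as `B`. -/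
theorem norm_sqrt_star_mul_self_apply (B : H →L[ℂ] H) (x : H) :
    ‖CFC.sqrt (star B * B) x‖ = ‖B x‖ := by
  have h := norm_sqrt_apply_sq (star_mul_self_nonneg B) x
  rw [mul_apply_eq_comp, ContinuousLinearMap.star_eq_adjoint,
    ContinuousLinearMap.adjoint_inner_right, inner_self_eq_norm_sq] at h
  exact (sq_eq_sq₀ (norm_nonneg _) (norm_nonneg _)).1 h

theorem traceNorm_eq_tsum_sq (B : H →L[ℂ] H) :
    traceNorm B =
      ∑' i, ENNReal.ofReal (‖CFC.sqrt (CFC.sqrt (star B * B)) (basis H i)‖ ^ 2) := by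
  simp only [traceNorm, norm_sqrt_apply_sq (CFC.sqrt_nonneg (star B * B))]

theorem summable_of_traceNorm_ne_top {B : H →L[ℂ] H} (hB : traceNorm B ≠ ∞) :
    Summable fun i => ‖CFC.sqrt (CFC.sqrt (star B * B)) (basis H i)‖ ^ 2 := by
  rw [traceNorm_eq_tsum_sq] at hB
  have := ENNReal.summable_toReal hB
  simpa [ENNReal.toReal_ofReal] using this

/-- The trace norm dominates the trace: `|Tr (C B)| ≤ ‖C‖ ‖B‖₁`. -/
theorem norm_trace_mul_le_traceNorm {B : H →L[ℂ] H} (hB : traceNorm B ≠ ∞) (C : H →L[ℂ] H) :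
    ‖trace (C * B)‖ ≤ ‖C‖ * (traceNorm B).toReal := by
  -- Half of a polar decomposition: `B = U |B|` with `U` a contraction.
  obtain ⟨U, hU, hU1⟩ := exists_eq_mul_of_norm_le
    (fun x => (norm_sqrt_star_mul_self_apply B x).ge)
  have hs := summable_of_traceNorm_ne_top hB
  have hr := hasRankOneSum_sqrt (CFC.sqrt_nonneg (star B * B)) hs
  have h₁ := hr.norm_trace_mul_le (C * U)
  rw [mul_assoc, ← hU] at h₁
  have h₂ : (traceNorm B).toReal =
      ∑' i, ‖CFC.sqrt (CFC.sqrt (star B * B)) (basis H i)‖ ^ 2 := by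
    rw [traceNorm_eq_tsum_sq, ← ENNReal.ofReal_tsum_of_nonneg (fun _ => by positivity) hs,
      ENNReal.toReal_ofReal (tsum_nonneg fun _ => by positivity)]
  simp only [← sq] at h₁
  rw [h₂]
  refine h₁.trans ?_
  gcongr
  calc ‖C * U‖ ≤ ‖C‖ * ‖U‖ := norm_mul_le _ _
    _ ≤ ‖C‖ * 1 := by gcongr
    _ = ‖C‖ := mul_one _

/-- The trace norm is at most the nuclear norm of any representation. -/
theorem HasRankOneSum.traceNorm_le {ι : Type*} {B : H →L[ℂ] H} {x y : ι → H}
    (h : HasRankOneSum B x y) : traceNorm B ≤ ENNReal.ofReal (∑' i, ‖x i‖ * ‖y i‖) := by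
  -- The other half, `|B| = V B`, turns the trace norm into the trace of `V B`.
  obtain ⟨V, hV, hV1⟩ := exists_eq_mul_of_norm_le
    (fun x => (norm_sqrt_star_mul_self_apply B x).le)
  have h₁ := Complex.hasSum_re (h.mul_left V).hasTrace.hasSum
  have h₂ := h.norm_trace_mul_le V
  rw [← hV] at h₁ h₂
  have h₃ : traceNorm B = ENNReal.ofReal (trace (CFC.sqrt (star B * B))).re := by
    rw [← h₁.tsum_eq, ENNReal.ofReal_tsum_of_nonneg _ h₁.summable]
    · rfl
    · intro i
      exact ((ContinuousLinearMap.nonneg_iff_isPositive _).1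
        (CFC.sqrt_nonneg (star B * B))).re_inner_nonneg_right _
  rw [h₃]
  refine ENNReal.ofReal_le_ofReal ((Complex.re_le_norm _).trans (h₂.trans ?_))
  exact mul_le_of_le_one_left (tsum_nonneg fun _ => by positivity) hV1

theorem HasRankOneSum.norm_le {ι : Type*} {A : H →L[ℂ] H} {x y : ι → H}
    (h : HasRankOneSum A x y) : ‖A‖ ≤ ∑' i, ‖x i‖ * ‖y i‖ := by
  have hc : 0 ≤ ∑' i, ‖x i‖ * ‖y i‖ := tsum_nonneg fun _ => by positivity
  refine ContinuousLinearMap.opNorm_le_bound _ hc fun u => ?_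
  rcases (norm_nonneg (A u)).eq_or_lt with h₀ | h₀
  · rw [← h₀]; positivity
  have h₁ : ‖⟪A u, A u⟫_ℂ‖ ≤ (∑' i, ‖x i‖ * ‖y i‖) * (‖A u‖ * ‖u‖) := by
    rw [← (h.hasSum u (A u)).tsum_eq]
    refine tsum_of_norm_bounded (h.summable.hasSum.mul_right _) fun i => ?_
    rw [norm_mul]
    calc ‖⟪A u, x i⟫_ℂ‖ * ‖⟪y i, u⟫_ℂ‖ ≤ (‖A u‖ * ‖x i‖) * (‖y i‖ * ‖u‖) := by
          gcongr <;> exact norm_inner_le_norm _ _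
      _ = ‖x i‖ * ‖y i‖ * (‖A u‖ * ‖u‖) := by ring
  rw [← inner_self_re_eq_norm, inner_self_eq_norm_mul_norm] at h₁
  refine le_of_mul_le_mul_left ?_ h₀
  linarith

/-- The square root of a positive trace class operator is Hilbert-Schmidt. -/
theorem summable_sqrt_of_isTraceClass {A : H →L[ℂ] H} (hA : 0 ≤ A) (h : IsTraceClass A) :
    Summable fun i => ‖CFC.sqrt A (basis H i)‖ ^ 2 := by
  have := summable_of_traceNorm_ne_top h
  rwa [hA.isSelfAdjoint.star_eq, CFC.sqrt_mul_self A] at this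

theorem IsTraceClass.hasTrace {A : H →L[ℂ] H} (h : IsTraceClass A) (hA : 0 ≤ A) : HasTrace A :=
  (hasRankOneSum_sqrt hA (summable_sqrt_of_isTraceClass hA h)).hasTrace

/-- A positive operator is bounded by its trace. -/
theorem HasTrace.norm_le_trace {A : H →L[ℂ] H} (h : HasTrace A) (hA : 0 ≤ A) :
    ‖A‖ ≤ (trace A).re := by
  have h₁ := Complex.hasSum_re h.hasSum
  have h₂ : ∀ i, (⟪basis H i, A (basis H i)⟫_ℂ).re = ‖CFC.sqrt A (basis H i)‖ ^ 2 := fun i =>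
    (norm_sqrt_apply_sq hA _).symm
  simp only [h₂] at h₁
  have h₃ := (hasRankOneSum_sqrt hA h₁.summable).norm_le
  simpa only [← sq, h₁.tsum_eq] using h₃

/-! ### Positive parts and the variational principle for their trace -/

section PositivePart

variable {A B : H →L[ℂ] H}

theorem positiveProjection_mul_posPart (A : H →L[ℂ] H) :
    positiveProjection A * A⁺ = A⁺ := by
  ext x
  exact Submodule.starProjection_eq_self_iff.2
    (Submodule.le_topologicalClosure _ (LinearMap.mem_range_self _ x))

theorem positiveProjection_mul_negPart (A : H →L[ℂ] H) :
    positiveProjection A * A⁻ = 0 := by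
  ext x
  have h : A⁻ x ∈ (A⁺).range.topologicalClosureᗮ := by
    rw [Submodule.orthogonal_closure, Submodule.mem_orthogonal]
    rintro _ ⟨y, rfl⟩
    have h₁ : A⁺ * A⁻ = 0 := CFC.posPart_mul_negPart A
    have h₂ : ContinuousLinearMap.adjoint A⁺ = A⁺ := (CFC.posPart_nonneg A).isSelfAdjoint
    have h₃ : A⁺ (A⁻ x) = 0 := by rw [← mul_apply_eq_comp, h₁]; rfl
    calc ⟪A⁺ y, A⁻ x⟫_ℂ = ⟪y, A⁺ (A⁻ x)⟫_ℂ := by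
          conv_lhs => rw [← h₂, ContinuousLinearMap.adjoint_inner_left]
      _ = 0 := by rw [h₃, inner_zero_right]
  exact (Submodule.starProjection_apply_eq_zero_iff _).2 h

/-- The projection fixes the range of `A⁺` and kills that of `A⁻`. It is thus a test operator
attaining `Tr [A]₊`. -/
theorem positiveProjection_mul_self (hA : IsSelfAdjoint A) : positiveProjection A * A = A⁺ := by
  calc positiveProjection A * A = positiveProjection A * (A⁺ - A⁻) := by
        rw [CFC.posPart_sub_negPart A hA]
    _ = A⁺ := by
        rw [mul_sub, positiveProjection_mul_posPart, positiveProjection_mul_negPart, sub_zero]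

theorem positiveProjection_nonneg (A : H →L[ℂ] H) : 0 ≤ positiveProjection A := by
  exact isStarProjection_starProjection.nonneg

theorem positiveProjection_le_one (A : H →L[ℂ] H) : positiveProjection A ≤ 1 := by
  exact isStarProjection_starProjection.le_one

theorem norm_positiveProjection_le (A : H →L[ℂ] H) : ‖positiveProjection A‖ ≤ 1 :=
  Submodule.starProjection_norm_le _

theorem HasTrace.posPart (h : HasTrace A) (hA : IsSelfAdjoint A) : HasTrace A⁺ :=
  positiveProjection_mul_self hA ▸ h.mul_left _

theorem HasTrace.negPart (h : HasTrace A) (hA : IsSelfAdjoint A) : HasTrace A⁻ := by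
  have : A⁻ = A⁺ - A := by
    rw [eq_sub_iff_add_eq', ← eq_sub_iff_add_eq, CFC.posPart_sub_negPart A hA]
  rw [this]
  exact (h.posPart hA).sub h

/-- `Tr [A]₊` is the maximum of `Tr (X A)` over `0 ≤ X ≤ 1`. -/
theorem HasTrace.trace_mul_le_trace_posPart (h : HasTrace A) (hA : IsSelfAdjoint A)
    {X : H →L[ℂ] H} (hX : 0 ≤ X) (hX1 : X ≤ 1) : (trace (X * A)).re ≤ (trace A⁺).re := by
  have hp := h.posPart hA
  have hn := h.negPart hA
  have h₁ : trace (X * A) = trace (X * A⁺) - trace (X * A⁻) := by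
    rw [← (hp.mul_left X).trace_sub (hn.mul_left X), ← mul_sub, CFC.posPart_sub_negPart A hA]
  have h₂ := hn.trace_mul_nonneg (CFC.negPart_nonneg A) hX
  have h₃ := hp.trace_mul_nonneg (CFC.posPart_nonneg A) (sub_nonneg.2 hX1)
  rw [sub_mul, one_mul, hp.trace_sub (hp.mul_left X)] at h₃
  simp only [Complex.sub_re, h₁] at *
  linarith

/-- The optimal test for `A` is an admissible test for `B`. -/
theorem HasTrace.trace_posPart_mono (h : HasTrace A) (hA : IsSelfAdjoint A) (h' : HasTrace B)
    (hB : IsSelfAdjoint B) (hAB : A ≤ B) : (trace A⁺).re ≤ (trace B⁺).re := by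
  have h₁ := h'.trace_mul_le_trace_posPart hB (positiveProjection_nonneg A)
    (positiveProjection_le_one A)
  have h₂ := (h'.sub h).trace_mul_nonneg (sub_nonneg.2 hAB) (positiveProjection_nonneg A)
  rw [mul_sub, (h'.mul_left _).trace_sub (h.mul_left _), positiveProjection_mul_self hA,
    Complex.sub_re] at h₂
  linarith

theorem HasTrace.trace_posPart_add_le (h : HasTrace A) (hA : IsSelfAdjoint A) (h' : HasTrace B)
    (hB : 0 ≤ B) : (trace (A + B)⁺).re ≤ (trace A⁺).re + (trace B).re := by
  have h₁ := h.trace_mul_le_trace_posPart hA (positiveProjection_nonneg (A + B))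
    (positiveProjection_le_one _)
  have h₂ := h'.trace_mul_nonneg hB (sub_nonneg.2 (positiveProjection_le_one (A + B)))
  rw [sub_mul, one_mul, h'.trace_sub (h'.mul_left _), Complex.sub_re] at h₂
  rw [← positiveProjection_mul_self (hA.add hB.isSelfAdjoint), mul_add,
    (h.mul_left _).trace_add (h'.mul_left _), Complex.add_re]
  linarith

end PositivePart

end

/-! ### The Lagrange operator and its violations -/

section

namespace Ensemble

theorem op_nonneg (E : Ensemble K H) (k : K) : 0 ≤ E.op k :=
  (ContinuousLinearMap.nonneg_iff_isPositive _).2 (E.isPositive k)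

theorem hasTrace (E : Ensemble K H) (k : K) : HasTrace (E.op k) :=
  (E.isTraceClass k).hasTrace (E.op_nonneg k)

/-- The vectors `√(ρ k) (e i)`; the rank one operators they define add up to the ensemble. -/
noncomputable def vec (E : Ensemble K H) (j : K × basisSet H) : H :=
  CFC.sqrt (E.op j.1) (basis H j.2)

theorem hasRankOneSum (E : Ensemble K H) (k : K) :
    HasRankOneSum (E.op k) (fun i => E.vec (k, i)) (fun i => E.vec (k, i)) :=
  hasRankOneSum_sqrt (E.op_nonneg k) (summable_sqrt_of_isTraceClass (E.op_nonneg k)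
    (E.isTraceClass k))

theorem hasSum_norm_vec_sq_fiber (E : Ensemble K H) (k : K) :
    HasSum (fun i => ‖E.vec (k, i)‖ ^ 2) (trace (E.op k)).re := by
  have := Complex.hasSum_re (E.hasRankOneSum k).hasSum_inner
  convert this using 2 with i
  exact (inner_self_eq_norm_sq (𝕜 := ℂ) _).symm

theorem hasSum_re_trace (E : Ensemble K H) : HasSum (fun k => (trace (E.op k)).re) 1 := by
  simpa using Complex.hasSum_re E.hasSum_trace

theorem nonempty (E : Ensemble K H) : Nonempty K := by
  by_contra hK
  rw [not_nonempty_iff] at hK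
  exact one_ne_zero (E.hasSum_re_trace.unique hasSum_empty)

theorem re_trace_nonneg (E : Ensemble K H) (k : K) : 0 ≤ (trace (E.op k)).re :=
  (E.hasTrace k).trace_nonneg (E.op_nonneg k)

theorem re_trace_le_one (E : Ensemble K H) (k : K) : (trace (E.op k)).re ≤ 1 :=
  le_hasSum E.hasSum_re_trace k fun j _ => E.re_trace_nonneg j

theorem hasSum_norm_vec_sq (E : Ensemble K H) : HasSum (fun j => ‖E.vec j‖ ^ 2) 1 := by
  have hs : Summable fun j => ‖E.vec j‖ ^ 2 := by
    refine (summable_prod_of_nonneg fun _ => by positivity).2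
      ⟨fun k => (E.hasSum_norm_vec_sq_fiber k).summable, ?_⟩
    simp only [(E.hasSum_norm_vec_sq_fiber _).tsum_eq]
    exact E.hasSum_re_trace.summable
  have h := hs.hasSum.prod_fiberwise E.hasSum_norm_vec_sq_fiber
  exact h.unique E.hasSum_re_trace ▸ hs.hasSum

end Ensemble

namespace POVM

theorem op_nonneg (M : POVM K H) (k : K) : 0 ≤ M.op k :=
  (ContinuousLinearMap.nonneg_iff_isPositive _).2 (M.isPositive k)

theorem hasSum_re_inner (M : POVM K H) (x : H) :
    HasSum (fun k => (⟪x, M.op k x⟫_ℂ).re) (‖x‖ ^ 2) := by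
  have := Complex.hasSum_re ((innerSL ℂ x).hasSum (M.hasSum_apply x))
  simpa [← inner_self_eq_norm_sq (𝕜 := ℂ)] using this

theorem op_le_one (M : POVM K H) (k : K) : M.op k ≤ 1 := by
  rw [ContinuousLinearMap.le_def, ContinuousLinearMap.isPositive_def']
  refine ⟨(IsSelfAdjoint.one _).sub (M.isPositive k).isSelfAdjoint, fun x => ?_⟩
  have h := le_hasSum (M.hasSum_re_inner x) k fun j _ => (M.isPositive j).re_inner_nonneg_right x
  have h₁ : RCLike.re ⟪x, x⟫_ℂ = ‖x‖ ^ 2 := inner_self_eq_norm_sq x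
  have h₂ : RCLike.re ⟪M.op k x, x⟫_ℂ = RCLike.re ⟪x, M.op k x⟫_ℂ := inner_re_symm _ _
  rw [ContinuousLinearMap.reApplyInnerSelf_apply, sub_apply, inner_sub_left,
    map_sub, h₂, one_apply_eq_self, h₁, sub_nonneg]
  exact h

theorem norm_op_le_one (M : POVM K H) (k : K) : ‖M.op k‖ ≤ 1 :=
  (CStarAlgebra.norm_le_one_iff_of_nonneg _ (M.op_nonneg k)).2 (M.op_le_one k)

end POVM

variable (E : Ensemble K H) (M : POVM K H)

theorem hasSum_lagrange : HasSum (fun k => M.op k * E.op k) (lagrange E M) := by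
  refine Summable.hasSum (E.hasSum_re_trace.summable.of_norm_bounded fun k => ?_)
  calc ‖M.op k * E.op k‖ ≤ ‖M.op k‖ * ‖E.op k‖ := norm_mul_le _ _
    _ ≤ 1 * (trace (E.op k)).re := by
        gcongr
        · exact M.norm_op_le_one k
        · exact (E.hasTrace k).norm_le_trace (E.op_nonneg k)
    _ = _ := one_mul _

theorem norm_op_vec_le (j : K × basisSet H) : ‖M.op j.1 (E.vec j)‖ ≤ ‖E.vec j‖ :=
  ((M.op j.1).le_opNorm _).trans (mul_le_of_le_one_left (norm_nonneg _) (M.norm_op_le_one _))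

/-- Writing `L` as one absolutely convergent series over pairs `(k, i)` gives its trace property and
lets traces be summed over `k`. -/
theorem hasRankOneSum_lagrange :
    HasRankOneSum (lagrange E M) (fun j => M.op j.1 (E.vec j)) E.vec where
  summable := E.hasSum_norm_vec_sq.summable.of_nonneg_of_le (fun j => by positivity) fun j => by
    rw [sq]
    gcongr
    exact norm_op_vec_le E M j
  hasSum u v := by
    have hs : Summable fun j => ⟪v, M.op j.1 (E.vec j)⟫_ℂ * ⟪E.vec j, u⟫_ℂ := by
      refine (E.hasSum_norm_vec_sq.summable.mul_left (‖v‖ * ‖u‖)).of_norm_bounded fun j => ?_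
      rw [norm_mul]
      calc ‖⟪v, M.op j.1 (E.vec j)⟫_ℂ‖ * ‖⟪E.vec j, u⟫_ℂ‖
          ≤ (‖v‖ * ‖M.op j.1 (E.vec j)‖) * (‖E.vec j‖ * ‖u‖) := by
            gcongr <;> exact norm_inner_le_norm _ _
        _ ≤ (‖v‖ * ‖E.vec j‖) * (‖E.vec j‖ * ‖u‖) := by
            gcongr
            exact norm_op_vec_le E M j
        _ = _ := by ring
    have h₀ : ∀ k, HasSum (fun i => ⟪v, M.op k (E.vec (k, i))⟫_ℂ * ⟪E.vec (k, i), u⟫_ℂ)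
        ⟪v, (M.op k * E.op k) u⟫_ℂ := fun k =>
      ((E.hasRankOneSum k).mul_left (M.op k)).hasSum u v
    have h₁ := HasSum.prod_fiberwise hs.hasSum h₀
    have h₃ : HasSum (fun k => (M.op k * E.op k) u) (lagrange E M u) :=
      (hasSum_lagrange E M).mapL (ContinuousLinearMap.apply ℂ H u)
    have h₂ : HasSum (fun k => ⟪v, (M.op k * E.op k) u⟫_ℂ) ⟪v, lagrange E M u⟫_ℂ :=
      h₃.mapL (innerSL ℂ v)
    exact h₁.unique h₂ ▸ hs.hasSum

theorem hasTrace_lagrange : HasTrace (lagrange E M) :=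
  (hasRankOneSum_lagrange E M).hasTrace

theorem hasSum_successProb :
    HasSum (fun j => (⟪E.vec j, M.op j.1 (E.vec j)⟫_ℂ).re) (successProb E M) :=
  Complex.hasSum_re (hasRankOneSum_lagrange E M).hasSum_inner

theorem successProb_nonneg : 0 ≤ successProb E M := by
  refine (hasSum_successProb E M).nonneg fun j => ?_
  exact (M.isPositive j.1).re_inner_nonneg_right (E.vec j)

theorem hasSum_trace_mul_lagrange (B : H →L[ℂ] H) :
    HasSum (fun k => trace (B * (M.op k * E.op k))) (trace (B * lagrange E M)) := by
  have h₀ : ∀ k, HasSum (fun i => ⟪E.vec (k, i), B (M.op k (E.vec (k, i)))⟫_ℂ)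
      (trace (B * (M.op k * E.op k))) := fun k =>
    (((E.hasRankOneSum k).mul_left (M.op k)).mul_left B).hasSum_inner
  exact HasSum.prod_fiberwise ((hasRankOneSum_lagrange E M).mul_left B).hasSum_inner h₀

theorem norm_trace_mul_lagrange_le (B : H →L[ℂ] H) : ‖trace (B * lagrange E M)‖ ≤ ‖B‖ := by
  refine ((hasRankOneSum_lagrange E M).norm_trace_mul_le B).trans ?_
  refine mul_le_of_le_one_right (norm_nonneg _) ?_
  rw [← E.hasSum_norm_vec_sq.tsum_eq]
  refine (hasRankOneSum_lagrange E M).summable.tsum_le_tsum (fun j => ?_)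
    E.hasSum_norm_vec_sq.summable
  rw [sq]
  gcongr
  exact norm_op_vec_le E M j

theorem successProb_le_one : successProb E M ≤ 1 := by
  have h₁ := norm_trace_mul_lagrange_le E M 1
  rw [one_mul] at h₁
  exact (Complex.re_le_norm _).trans
    (h₁.trans (ContinuousLinearMap.norm_id_le (𝕜 := ℂ) (E := H)))

theorem isSelfAdjoint_opRe (A : H →L[ℂ] H) : IsSelfAdjoint (opRe A) := by
  simp [IsSelfAdjoint, opRe, add_comm]

theorem HasTrace.opRe {A : H →L[ℂ] H} (h : HasTrace A) : HasTrace (opRe A) :=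
  (h.add h.adjoint).smul _

/-- For self-adjoint `X`, `Tr (X A†)` is the conjugate of `Tr (X A)`. Hence `Re L` may be replaced
by `L` in the estimates. -/
theorem HasTrace.re_trace_mul_opRe {A X : H →L[ℂ] H} (h : HasTrace A) (hX : IsSelfAdjoint X) :
    (trace (X * QuantumDetection.opRe A)).re = (trace (X * A)).re := by
  have h₁ : trace (X * star A) = star (trace (X * A)) := by
    rw [← trace_adjoint, star_mul, hX.star_eq, h.adjoint.trace_mul_comm]
  rw [QuantumDetection.opRe, mul_smul_comm, trace_smul, mul_add,
    (h.mul_left X).trace_add (h.adjoint.mul_left X), h₁]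
  simp only [Complex.mul_re, Complex.add_re, Complex.star_def, Complex.conj_re]
  norm_num
  ring

variable (l : K)

theorem isSelfAdjoint_gap : IsSelfAdjoint (gap E M l) :=
  (E.isPositive l).isSelfAdjoint.sub (isSelfAdjoint_opRe _)

theorem hasTrace_gap : HasTrace (gap E M l) :=
  (E.hasTrace l).sub (hasTrace_lagrange E M).opRe

theorem hasTrace_gap_posPart : HasTrace (gap E M l)⁺ :=
  (hasTrace_gap E M l).posPart (isSelfAdjoint_gap E M l)

theorem violation_nonneg : 0 ≤ violation E M l :=
  (hasTrace_gap_posPart E M l).trace_nonneg (CFC.posPart_nonneg _)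

theorem re_trace_mul_gap {X : H →L[ℂ] H} (hX : IsSelfAdjoint X) :
    (trace (X * gap E M l)).re =
      (trace (X * E.op l)).re - (trace (X * lagrange E M)).re := by
  rw [gap, mul_sub, ((E.hasTrace l).mul_left X).trace_sub
    ((hasTrace_lagrange E M).opRe.mul_left X), Complex.sub_re,
    (hasTrace_lagrange E M).re_trace_mul_opRe hX]

theorem violation_eq : violation E M l =
    (trace (positiveProjection (gap E M l) * E.op l)).re -
      (trace (positiveProjection (gap E M l) * lagrange E M)).re := by
  rw [← re_trace_mul_gap E M l (positiveProjection_nonneg _).isSelfAdjoint,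
    positiveProjection_mul_self (isSelfAdjoint_gap E M l), violation]

/-- Both traces in `violation_eq` have absolute value at most one. The bound keeps `2 X - X²`
nonnegative for the prescribed `X`. -/
theorem violation_le_two : violation E M l ≤ 2 := by
  set P := positiveProjection (gap E M l) with hP
  have h₁ := (E.hasTrace l).trace_mul_nonneg (E.op_nonneg l)
    (sub_nonneg.2 (positiveProjection_le_one (gap E M l)))
  rw [sub_mul, one_mul, (E.hasTrace l).trace_sub ((E.hasTrace l).mul_left _), Complex.sub_re,
    ← hP] at h₁
  have h₂ := (norm_trace_mul_lagrange_le E M P).trans (norm_positiveProjection_le _)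
  have h₃ := neg_le_of_abs_le ((Complex.abs_re_le_norm (trace (P * lagrange E M))).trans h₂)
  have h₄ := E.re_trace_le_one l
  rw [violation_eq, ← hP]
  linarith

/-- Some hypothesis has maximal violation. -/
theorem exists_violation_max : ∃ l, ∀ j, violation E M j ≤ violation E M l := by
  -- Violations lie between `c` and `c + Tr (ρ k)`. Since the traces are summable, only finitely
  -- many violations exceed a level above `c`; if none exceeds `c`, all equal `c`.
  set c := (trace (-opRe (lagrange E M))⁺).re with hc
  have hR := (hasTrace_lagrange E M).opRe.neg
  have hRs := (isSelfAdjoint_opRe (lagrange E M)).neg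
  have hlow : ∀ k, c ≤ violation E M k := fun k =>
    hR.trace_posPart_mono hRs (hasTrace_gap E M k) (isSelfAdjoint_gap E M k) (by
      rw [gap, sub_eq_add_neg]
      exact le_add_of_nonneg_left (E.op_nonneg k))
  have hup : ∀ k, violation E M k ≤ c + (trace (E.op k)).re := fun k => by
    have := hR.trace_posPart_add_le hRs (E.hasTrace k) (E.op_nonneg k)
    rwa [neg_add_eq_sub] at this
  by_cases h : ∃ k₀, c < violation E M k₀
  · obtain ⟨k₀, hk₀⟩ := h
    have hfin : {k | violation E M k₀ ≤ violation E M k}.Finite := by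
      have h₁ : ∀ᶠ k in cofinite, (trace (E.op k)).re < violation E M k₀ - c :=
        E.hasSum_re_trace.summable.tendsto_cofinite_zero.eventually_lt_const (sub_pos.2 hk₀)
      refine Set.Finite.subset h₁ fun k hk => ?_
      simp only [Set.mem_compl_iff, Set.mem_ofPred_eq, not_lt] at hk ⊢
      linarith [hup k]
    obtain ⟨l, hl, hmax⟩ := Set.exists_max_image _ (violation E M) hfin ⟨k₀, by simp⟩
    refine ⟨l, fun j => ?_⟩
    rcases le_total (violation E M k₀) (violation E M j) with hj | hj
    · exact hmax j hj
    · exact hj.trans hl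
  · push Not at h
    exact ⟨E.nonempty.some, fun j => (h j).trans (hlow _)⟩

end

/-! ### One iteration step -/

section

theorem inner_apply_left_of_isSelfAdjoint {A : H →L[ℂ] H} (hA : IsSelfAdjoint A) (x y : H) :
    ⟪A x, y⟫_ℂ = ⟪x, A y⟫_ℂ := by
  have h : ContinuousLinearMap.adjoint A = A := hA
  conv_lhs => rw [← h, ContinuousLinearMap.adjoint_inner_left]

theorem isSelfAdjoint_real_smul {A : H →L[ℂ] H} (hA : IsSelfAdjoint A) (a : ℝ) :
    IsSelfAdjoint ((a : ℂ) • A) := by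
  rw [IsSelfAdjoint, star_smul, hA.star_eq, Complex.star_def, Complex.conj_ofReal]

theorem isSelfAdjoint_positiveProjection (A : H →L[ℂ] H) : IsSelfAdjoint (positiveProjection A) :=
  isStarProjection_starProjection.isSelfAdjoint

theorem positiveProjection_mul_positiveProjection (A : H →L[ℂ] H) :
    positiveProjection A * positiveProjection A = positiveProjection A :=
  isStarProjection_starProjection.isIdempotentElem

theorem two_smul_sub_sq_nonneg (A : H →L[ℂ] H) {a : ℝ} (ha : 0 ≤ a) (ha2 : a ≤ 2) :
    0 ≤ (2 : ℂ) • ((a : ℂ) • positiveProjection A) - ((a : ℂ) • positiveProjection A) ^ 2 := by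
  have h : (2 : ℂ) • ((a : ℂ) • positiveProjection A) - ((a : ℂ) • positiveProjection A) ^ 2 =
      ((a * (2 - a) : ℝ) : ℂ) • positiveProjection A := by
    rw [sq, smul_mul_smul_comm, positiveProjection_mul_positiveProjection, smul_smul, ← sub_smul]
    congr 1
    push_cast
    ring
  rw [h, ContinuousLinearMap.nonneg_iff_isPositive]
  refine ((ContinuousLinearMap.nonneg_iff_isPositive _).1
    (positiveProjection_nonneg A)).smul_of_nonneg ?_
  exact Complex.zero_le_real.2 (mul_nonneg ha (sub_nonneg.2 ha2))

theorem hasSum_modification (M : POVM K H) (X : H →L[ℂ] H) (l : K) (x : H) :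
    HasSum (fun k => modification M X l k x) x := by
  classical
  have h₁ : HasSum (fun k => (1 - X) (M.op k ((1 - X) x))) ((1 - X) ((1 - X) x)) :=
    (M.hasSum_apply ((1 - X) x)).mapL (1 - X)
  have h₂ := hasSum_ite_eq l (((2 : ℂ) • X - X ^ 2) x)
  have h₃ := h₁.add h₂
  -- The correction at `l` is exactly `1 - (1 - X)²`.
  have h₄ : (1 - X) ((1 - X) x) + ((2 : ℂ) • X - X ^ 2) x = x := by
    simp [sq, two_smul]
    abel
  rw [h₄] at h₃
  convert h₃ using 2 with k
  rw [modification, add_apply, mul_apply_eq_comp, mul_apply_eq_comp]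
  split_ifs
  · rfl
  · rw [zero_apply]

theorem modification_nonneg (M : POVM K H) {X : H →L[ℂ] H} (hX : IsSelfAdjoint X)
    (hX2 : 0 ≤ (2 : ℂ) • X - X ^ 2) (l k : K) : 0 ≤ modification M X l k := by
  have h₁ : 0 ≤ (1 - X) * M.op k * (1 - X) := by
    have := star_left_conjugate_nonneg (M.op_nonneg k) (1 - X)
    rwa [((IsSelfAdjoint.one _).sub hX).star_eq] at this
  rw [modification]
  split_ifs
  · exact add_nonneg h₁ hX2
  · rwa [add_zero]

theorem exists_isIterate (E : Ensemble K H) (M : POVM K H) : ∃ M', IsIterate E M M' := by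
  obtain ⟨l, hl⟩ := exists_violation_max E M
  obtain ⟨X, hX⟩ : ∃ X, X = (violation E M l : ℂ) • positiveProjection (gap E M l) := ⟨_, rfl⟩
  have hXs : IsSelfAdjoint X := by
    rw [hX]
    exact isSelfAdjoint_real_smul (isSelfAdjoint_positiveProjection _) _
  have hX2 : 0 ≤ (2 : ℂ) • X - X ^ 2 := by
    rw [hX]
    exact two_smul_sub_sq_nonneg _ (violation_nonneg E M l) (violation_le_two E M l)
  let M' : POVM K H :=
    { op := modification M X l
      isPositive := fun k =>
        (ContinuousLinearMap.nonneg_iff_isPositive _).1 (modification_nonneg M hXs hX2 l k)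
      hasSum_apply := hasSum_modification M X l }
  have hM' : ∀ k, M'.op k = modification M X l k := fun _ => rfl
  rw [hX] at hM'
  exact ⟨M', l, hl, hM'⟩

/-- The two cross terms have the same real part, and the discarded term `⟪X s, A (X s)⟫` is
nonnegative. -/
theorem re_inner_conj_ge {A X : H →L[ℂ] H} (hA : A.IsPositive) (hX : IsSelfAdjoint X) (s : H) :
    (⟪s, A s⟫_ℂ).re - 2 * (⟪s, X (A s)⟫_ℂ).re ≤ (⟪s, ((1 - X) * A * (1 - X)) s⟫_ℂ).re := by
  have h₁ : ⟪s, ((1 - X) * A * (1 - X)) s⟫_ℂ =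
      ⟪s, A s⟫_ℂ - ⟪s, X (A s)⟫_ℂ - ⟪s, A (X s)⟫_ℂ + ⟪X s, A (X s)⟫_ℂ := by
    rw [inner_apply_left_of_isSelfAdjoint hX]
    simp only [mul_apply_eq_comp, sub_apply, one_apply_eq_self, map_sub, inner_sub_right]
    ring
  have h₂ : (⟪s, A (X s)⟫_ℂ).re = (⟪s, X (A s)⟫_ℂ).re := by
    rw [← inner_apply_left_of_isSelfAdjoint hA.isSelfAdjoint,
      ← inner_apply_left_of_isSelfAdjoint hX]
    exact inner_re_symm (𝕜 := ℂ) _ _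
  have h₃ : 0 ≤ (⟪X s, A (X s)⟫_ℂ).re := hA.re_inner_nonneg_right (X s)
  rw [h₁]
  simp only [Complex.add_re, Complex.sub_re, h₂]
  linarith

/-- An iteration step raises the success probability by at least the square of the maximal
violation. -/
theorem IsIterate.exists_add_sq_le {E : Ensemble K H} {M M' : POVM K H} (h : IsIterate E M M') :
    ∃ a : ℝ, 0 ≤ a ∧ (∀ j, violation E M j ≤ a) ∧
      successProb E M + a ^ 2 ≤ successProb E M' := by
  classical
  obtain ⟨l, hl, hM'⟩ := h
  set a := violation E M l with ha
  have ha0 : 0 ≤ a := violation_nonneg E M l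
  refine ⟨a, ha0, hl, ?_⟩
  set P := positiveProjection (gap E M l) with hP
  set X := (a : ℂ) • P with hX
  have hPs : IsSelfAdjoint P := isSelfAdjoint_positiveProjection _
  have hXs : IsSelfAdjoint X := isSelfAdjoint_real_smul hPs _
  have hXn : ‖X‖ ≤ a := by
    rw [hX, norm_smul, Complex.norm_of_nonneg ha0]
    exact mul_le_of_le_one_right ha0 (norm_positiveProjection_le _)
  clear_value X
  -- A lower bound for the contribution of `2 X - X²`, using `‖X v‖ ≤ a ‖v‖`; it lives on the fibre
  -- over `l`.
  let g : K × basisSet H → ℝ := fun j =>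
    if j.1 = l then 2 * (⟪E.vec j, X (E.vec j)⟫_ℂ).re - a ^ 2 * ‖E.vec j‖ ^ 2 else 0
  have hg : HasSum g (2 * (trace (X * E.op l)).re - a ^ 2 * (trace (E.op l)).re) := by
    have hinj : Function.Injective fun i : basisSet H => (l, i) := fun _ _ h => (Prod.ext_iff.1 h).2
    rw [← hinj.hasSum_iff]
    · have h₁ := (Complex.hasSum_re ((E.hasRankOneSum l).mul_left X).hasSum_inner).mul_left 2
      have h₂ := (E.hasSum_norm_vec_sq_fiber l).mul_left (a ^ 2)
      simpa [g, Function.comp_def] using h₁.sub h₂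
    · rintro ⟨k, i⟩ hki
      refine if_neg fun hk => hki ⟨i, ?_⟩
      exact Prod.ext hk.symm rfl
  have hL : HasSum (fun j => (⟪E.vec j, X (M.op j.1 (E.vec j))⟫_ℂ).re)
      (trace (X * lagrange E M)).re :=
    Complex.hasSum_re ((hasRankOneSum_lagrange E M).mul_left X).hasSum_inner
  have hsum := ((hasSum_successProb E M).sub (hL.mul_left 2)).add hg
  have hle : ∀ j, (⟪E.vec j, M.op j.1 (E.vec j)⟫_ℂ).re -
      2 * (⟪E.vec j, X (M.op j.1 (E.vec j))⟫_ℂ).re + g j ≤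
        (⟪E.vec j, M'.op j.1 (E.vec j)⟫_ℂ).re := by
    intro j
    rw [hM', modification, add_apply, inner_add_right, Complex.add_re]
    refine add_le_add (re_inner_conj_ge (M.isPositive j.1) hXs _) ?_
    simp only [g]
    split_ifs with hj
    · have h₁ : ⟪E.vec j, (X ^ 2) (E.vec j)⟫_ℂ = ⟪X (E.vec j), X (E.vec j)⟫_ℂ := by
        rw [inner_apply_left_of_isSelfAdjoint hXs, sq, mul_apply_eq_comp]
      have h₂ : (⟪X (E.vec j), X (E.vec j)⟫_ℂ).re = ‖X (E.vec j)‖ ^ 2 :=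
        inner_self_eq_norm_sq (𝕜 := ℂ) _
      have h₃ : ‖X (E.vec j)‖ ^ 2 ≤ a ^ 2 * ‖E.vec j‖ ^ 2 := by
        rw [← mul_pow]
        gcongr
        exact (X.le_opNorm _).trans (by gcongr)
      rw [sub_apply, smul_apply, inner_sub_right, inner_smul_right, h₁, Complex.sub_re, h₂]
      simp only [Complex.mul_re, Complex.re_ofNat, Complex.im_ofNat, zero_mul, sub_zero]
      linarith
    · simp
  have hfin := hasSum_le hle hsum (hasSum_successProb E M')
  have hv : a = (trace (P * E.op l)).re - (trace (P * lagrange E M)).re := violation_eq E M l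
  rw [hX, smul_mul_assoc, smul_mul_assoc, HasTrace.trace_smul, HasTrace.trace_smul,
    Complex.re_ofReal_mul, Complex.re_ofReal_mul] at hfin
  -- The linear terms gain `2 a²`, and this caps the quadratic loss at `a²`.
  have h₁ : a ^ 2 * (trace (E.op l)).re ≤ a ^ 2 :=
    mul_le_of_le_one_right (sq_nonneg a) (E.re_trace_le_one l)
  have h₂ : a * (trace (P * E.op l)).re - a * (trace (P * lagrange E M)).re = a ^ 2 := by
    rw [← mul_sub, ← hv, sq]
  linarith

theorem exists_isIterativeSeries (E : Ensemble K H) (M₀ : POVM K H) :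
    ∃ M : ℕ → POVM K H, M 0 = M₀ ∧ IsIterativeSeries E M := by
  choose f hf using exists_isIterate E
  exact ⟨fun n => f^[n] M₀, rfl, fun n => by
    simp only [Function.iterate_succ_apply']
    exact hf _⟩

end

/-! ### Bounding the optimality gap by the maximal violation -/

section

theorem star_starProjection (Λ : Submodule ℂ H) [Λ.HasOrthogonalProjection] :
    star Λ.starProjection = Λ.starProjection :=
  isStarProjection_starProjection.isSelfAdjoint

theorem norm_one_sub_starProjection_le (Λ : Submodule ℂ H) [Λ.HasOrthogonalProjection] :
    ‖1 - Λ.starProjection‖ ≤ 1 := by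
  have h : (1 : H →L[ℂ] H) - Λ.starProjection = Λᗮ.starProjection :=
    Λ.starProjection_orthogonal'.symm
  rw [h]
  exact Submodule.starProjection_norm_le _

/-- Compressions to a finite-dimensional subspace are finite sums of rank one operators. -/
theorem hasRankOneSum_mul_starProjection (Λ : Submodule ℂ H) [FiniteDimensional ℂ Λ]
    (A : H →L[ℂ] H) :
    HasRankOneSum (A * Λ.starProjection)
      (fun i => A (stdOrthonormalBasis ℂ Λ i)) (fun i => (stdOrthonormalBasis ℂ Λ i : H)) where
  summable := (hasSum_fintype _).summable
  hasSum u v := by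
    have h₁ : Λ.starProjection u =
        ∑ i, ⟪(stdOrthonormalBasis ℂ Λ i : H), u⟫_ℂ • (stdOrthonormalBasis ℂ Λ i : H) := by
      rw [Submodule.starProjection_apply,
        (stdOrthonormalBasis ℂ Λ).orthogonalProjectionOnto_apply_eq_sum]
      simp
    rw [mul_apply_eq_comp, h₁, map_sum, inner_sum]
    simp only [map_smul, inner_smul_right]
    simp only [mul_comm]
    exact hasSum_fintype _

variable (E : Ensemble K H) (M M' : POVM K H)

/-- The positive part has operator norm at most its trace, so a trace bound becomes an operator
inequality. -/
theorem violation_bound {a : ℝ} (ha : ∀ j, violation E M j ≤ a) (k : K) :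
    gap E M k ≤ (a : ℂ) • (1 : H →L[ℂ] H) := by
  have h₁ := (hasTrace_gap_posPart E M k).norm_le_trace (CFC.posPart_nonneg _)
  have h₂ : (gap E M k)⁺ ≤ algebraMap ℝ (H →L[ℂ] H) a :=
    (CStarAlgebra.norm_le_iff_le_algebraMap _ ((norm_nonneg _).trans (h₁.trans (ha k)))
      (CFC.posPart_nonneg _)).1 (h₁.trans (ha k))
  refine (CFC.le_posPart (isSelfAdjoint_gap E M k)).trans (h₂.trans_eq ?_)
  rw [Algebra.algebraMap_eq_smul_one]
  rfl

/-- `Tr (Π M' k Π (ρ k - Re L)) ≤ a Tr (Π M' k Π)` when all violations are at most `a`. -/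
theorem trace_compression_le {Λ : Submodule ℂ H} [FiniteDimensional ℂ Λ] {a : ℝ}
    (ha : ∀ j, violation E M j ≤ a) (k : K) :
    (trace (Λ.starProjection * M'.op k * Λ.starProjection * E.op k)).re ≤
      (trace (opRe (lagrange E M) * (Λ.starProjection * M'.op k * Λ.starProjection))).re +
        a * (trace (Λ.starProjection * M'.op k * Λ.starProjection)).re := by
  set B := Λ.starProjection * M'.op k * Λ.starProjection with hB
  have hBt : HasTrace B :=
    (hasRankOneSum_mul_starProjection Λ (Λ.starProjection * M'.op k)).hasTrace
  have hB0 : 0 ≤ B := by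
    have := star_left_conjugate_nonneg (M'.op_nonneg k) Λ.starProjection
    rwa [star_starProjection] at this
  have h₁ := hBt.trace_mul_nonneg hB0 (sub_nonneg.2 (violation_bound E M ha k))
  have h₂ : ((a : ℂ) • (1 : H →L[ℂ] H) - gap E M k) * B =
      (a : ℂ) • B - (E.op k * B - opRe (lagrange E M) * B) := by
    rw [gap, sub_mul, sub_mul, smul_mul_assoc, one_mul]
  rw [h₂, (hBt.smul _).trace_sub ((hBt.mul_left _).sub (hBt.mul_left _)),
    (hBt.mul_left _).trace_sub (hBt.mul_left _), HasTrace.trace_smul, Complex.sub_re,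
    Complex.sub_re, Complex.re_ofReal_mul, ← hBt.trace_mul_comm (E.op k)] at h₁
  linarith

/-- On a finite-dimensional `Λ` the trace is a finite sum of matrix elements, so strong convergence
of the POVM suffices. -/
theorem hasSum_trace_mul_compression (Λ : Submodule ℂ H) [FiniteDimensional ℂ Λ] (R : H →L[ℂ] H) :
    HasSum (fun k => trace (R * (Λ.starProjection * M'.op k * Λ.starProjection)))
      (trace (R * Λ.starProjection)) := by
  have h₁ : ∀ k, trace (R * (Λ.starProjection * M'.op k * Λ.starProjection)) =
      ∑ i, ⟪(stdOrthonormalBasis ℂ Λ i : H),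
        R (Λ.starProjection (M'.op k (stdOrthonormalBasis ℂ Λ i)))⟫_ℂ := fun k => by
    rw [← mul_assoc, ← mul_assoc, (hasRankOneSum_mul_starProjection Λ _).trace_eq, tsum_fintype]
    rfl
  have h₂ : trace (R * Λ.starProjection) =
      ∑ i, ⟪(stdOrthonormalBasis ℂ Λ i : H),
        R (Λ.starProjection (stdOrthonormalBasis ℂ Λ i))⟫_ℂ := by
    rw [(hasRankOneSum_mul_starProjection Λ R).trace_eq, tsum_fintype]
    refine Finset.sum_congr rfl fun i _ => ?_
    rw [Submodule.starProjection_eq_self_iff.2 (stdOrthonormalBasis ℂ Λ i).2]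
  simp only [h₁, h₂]
  refine hasSum_sum fun i _ => ?_
  have h₃ : HasSum (fun k => (R * Λ.starProjection) (M'.op k (stdOrthonormalBasis ℂ Λ i)))
      ((R * Λ.starProjection) (stdOrthonormalBasis ℂ Λ i)) :=
    (M'.hasSum_apply (stdOrthonormalBasis ℂ Λ i : H)).mapL (R * Λ.starProjection)
  exact h₃.mapL (innerSL ℂ (stdOrthonormalBasis ℂ Λ i : H))

theorem trace_starProjection (Λ : Submodule ℂ H) [FiniteDimensional ℂ Λ] :
    trace Λ.starProjection = (Module.finrank ℂ Λ : ℂ) := by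
  have h := (hasRankOneSum_mul_starProjection Λ 1).trace_eq
  rw [one_mul, tsum_fintype] at h
  rw [h]
  have : ∀ i, ‖(stdOrthonormalBasis ℂ Λ i : H)‖ = 1 := (stdOrthonormalBasis ℂ Λ).norm_eq_one
  simp [this]

/-- The success probability of `M` is within `4 p + a dim Λ` of the optimum, when all violations are
at most `a` and the ensemble is within `p` of being supported on `Λ`. -/
theorem successProb_sub_le {Λ : Submodule ℂ H} [FiniteDimensional ℂ Λ] {a p : ℝ} (hp : 0 ≤ p)
    (ha : ∀ j, violation E M j ≤ a)
    (hΛ : ∑' k, traceNorm ((1 - Λ.starProjection) * E.op k) ≤ ENNReal.ofReal p) :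
    successProb E M' - successProb E M ≤ 4 * p + a * Module.finrank ℂ Λ := by
  set Q := 1 - Λ.starProjection with hQ
  have hQs : star Q = Q := by rw [hQ, star_sub, star_one, star_starProjection]
  have htop : ∀ k, traceNorm (Q * E.op k) ≠ ∞ := fun k =>
    ((ENNReal.le_tsum k).trans hΛ).trans_lt ENNReal.ofReal_lt_top |>.ne
  set t : K → ℝ := fun k => (traceNorm (Q * E.op k)).toReal with ht
  have hts : Summable t := ENNReal.summable_toReal (hΛ.trans_lt ENNReal.ofReal_lt_top).ne
  have htp : ∑' k, t k ≤ p := by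
    rw [ht, ← ENNReal.tsum_toReal_eq htop]
    exact ENNReal.toReal_le_of_le_ofReal hp hΛ
  have hbound : ∀ (C : H →L[ℂ] H), ‖C‖ ≤ 1 → ∀ k, |(trace (C * (Q * E.op k))).re| ≤ t k :=
    fun C hC k => (Complex.abs_re_le_norm _).trans
      ((norm_trace_mul_le_traceNorm (htop k) C).trans
        (mul_le_of_le_one_left ENNReal.toReal_nonneg hC))
  have hE := E.hasTrace
  have hEs : ∀ k, star (E.op k) = E.op k := fun k => (E.isPositive k).isSelfAdjoint
  have hMs : ∀ (N : POVM K H) k, star (N.op k) = N.op k :=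
    fun N k => (N.isPositive k).isSelfAdjoint
  have hPn : ‖Λ.starProjection‖ ≤ 1 := Submodule.starProjection_norm_le _
  have hmul : ∀ C D : H →L[ℂ] H, ‖C‖ ≤ 1 → ‖D‖ ≤ 1 → ‖C * D‖ ≤ 1 := fun C D hC hD =>
    (norm_mul_le C D).trans (mul_le_one₀ hC (norm_nonneg _) hD)
  have hone : Λ.starProjection + Q = 1 := by rw [hQ]; abel
  have hstar : ∀ A : H →L[ℂ] H, (trace (star A)).re = (trace A).re := fun A => by
    rw [HasTrace.trace_adjoint]; simp
  -- Split `ρ = Q ρ + Π ρ Π + Π ρ Q`, where `Π` projects onto `Λ`. Each term containing `Q` costs at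
  -- most `t k`; the last one is first turned around by taking adjoints.
  have h₁ : ∀ k, (trace (M'.op k * E.op k)).re ≤
      (trace (Λ.starProjection * M'.op k * Λ.starProjection * E.op k)).re + 2 * t k := fun k => by
    have e₁ : M'.op k * E.op k = M'.op k * (Q * E.op k) +
        (M'.op k * (Λ.starProjection * (E.op k * Λ.starProjection)) +
          M'.op k * (Λ.starProjection * (E.op k * Q))) := by
      rw [← mul_add, ← mul_add, ← mul_add, ← mul_add, hone, mul_one, ← add_mul, add_comm Q, hone,
        one_mul]
    have e₂ : trace (M'.op k * (Λ.starProjection * (E.op k * Λ.starProjection))) =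
        trace (Λ.starProjection * M'.op k * Λ.starProjection * E.op k) := by
      have := ((hE k).mul_left (M'.op k * Λ.starProjection)).trace_mul_comm Λ.starProjection
      simpa only [mul_assoc] using this
    have e₃ : (trace (M'.op k * (Λ.starProjection * (E.op k * Q)))).re =
        (trace (Λ.starProjection * M'.op k * (Q * E.op k))).re := by
      rw [← hstar]
      simp only [star_mul, hQs, hEs, hMs, star_starProjection]
      have := ((hE k).mul_left Q).trace_mul_comm (Λ.starProjection * M'.op k)
      simpa only [mul_assoc] using congrArg Complex.re this
    have b₁ := le_of_abs_le (hbound (M'.op k) (M'.norm_op_le_one k) k)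
    have b₂ := le_of_abs_le (hbound (Λ.starProjection * M'.op k)
      (hmul _ _ hPn (M'.norm_op_le_one k)) k)
    have hT : HasTrace (M'.op k * (Q * E.op k)) := ((hE k).mul_left _).mul_left _
    have hT₁ : HasTrace (M'.op k * (Λ.starProjection * (E.op k * Λ.starProjection))) :=
      (((hE k).mul_right _).mul_left _).mul_left _
    have hT₂ : HasTrace (M'.op k * (Λ.starProjection * (E.op k * Q))) :=
      (((hE k).mul_right _).mul_left _).mul_left _
    rw [e₁, hT.trace_add (hT₁.add hT₂), hT₁.trace_add hT₂, e₂, Complex.add_re, Complex.add_re, e₃]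
    linarith
  have h₂ : ∀ k, (trace (Λ.starProjection * (M.op k * E.op k))).re ≤
      (trace (M.op k * E.op k)).re + t k := fun k => by
    have hT : HasTrace (M.op k * E.op k) := (hE k).mul_left _
    have e₁ : (trace (Q * (M.op k * E.op k))).re = (trace (M.op k * (Q * E.op k))).re := by
      rw [← hstar]
      simp only [star_mul, hQs, hEs, hMs]
      have := ((hE k).mul_right (M.op k)).trace_mul_comm Q
      have h' := ((hE k).mul_left Q).trace_mul_comm (M.op k)
      simp only [mul_assoc] at this h'
      rw [mul_assoc, this, h']
    have b := neg_le_of_abs_le (hbound (M.op k) (M.norm_op_le_one k) k)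
    have e₂ := (hT.mul_left Λ.starProjection).trace_add (hT.mul_left Q)
    rw [← add_mul, hone, one_mul] at e₂
    rw [e₂, Complex.add_re, e₁]
    linarith
  have s : ∀ (N : POVM K H),
      HasSum (fun k => (trace (N.op k * E.op k)).re) (successProb E N) := fun N => by
    have := Complex.hasSum_re (hasSum_trace_mul_lagrange E N 1)
    simp only [one_mul] at this
    exact this
  have s₁ := Complex.hasSum_re (hasSum_trace_mul_compression M' Λ (opRe (lagrange E M)))
  have s₂ := Complex.hasSum_re (hasSum_trace_mul_compression M' Λ 1)
  simp only [one_mul, trace_starProjection, Complex.natCast_re] at s₂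
  have s₃ := Complex.hasSum_re (hasSum_trace_mul_lagrange E M Λ.starProjection)
  -- Compressing the competitor costs `2 p`, and replacing `Tr (Π L)` by `Tr L` costs `p`. The
  -- resulting `3 p` is relaxed to `4 p` by `hp`.
  have l₁ := hasSum_le (fun k => (h₁ k).trans (add_le_add_left
    (trace_compression_le E M M' ha k) _)) (s M') ((s₁.add (s₂.mul_left a)).add
      (hts.hasSum.mul_left 2))
  have l₂ := hasSum_le h₂ s₃ ((s M).add hts.hasSum)
  have e : (trace (opRe (lagrange E M) * Λ.starProjection)).re =
      (trace (Λ.starProjection * lagrange E M)).re := by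
    rw [(hasTrace_lagrange E M).opRe.trace_mul_comm,
      (hasTrace_lagrange E M).re_trace_mul_opRe (star_starProjection Λ)]
  linarith

end

/-! ### The `p`-dimension and convergence of the series -/

section

/-- A finite-dimensional subspace supports the ensemble up to an arbitrarily small error. -/
theorem exists_finiteDimensional_tsum_traceNorm_le (E : Ensemble K H) {p : ℝ} (hp : 0 < p) :
    ∃ (Λ : Submodule ℂ H) (_ : FiniteDimensional ℂ Λ),
      ∑' k, traceNorm ((1 - Λ.starProjection) * E.op k) ≤ ENNReal.ofReal p := by
  classical
  have hs := E.hasSum_norm_vec_sq.summable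
  obtain ⟨F, hF⟩ : ∃ F : Finset (K × basisSet H), 1 - p < ∑ j ∈ F, ‖E.vec j‖ ^ 2 :=
    (E.hasSum_norm_vec_sq.eventually_const_lt (by linarith : 1 - p < 1)).exists
  -- The spanning vectors carry all but `p` of the total mass one. The complementary projection
  -- kills them, leaving the tail `w`.
  let Λ : Submodule ℂ H := Submodule.span ℂ (F.image E.vec)
  have hfd : FiniteDimensional ℂ Λ := FiniteDimensional.span_finset ℂ _
  refine ⟨Λ, hfd, ?_⟩
  let w : K × basisSet H → ℝ := fun j => if j ∈ F then 0 else ‖E.vec j‖ ^ 2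
  have hw0 : ∀ j, 0 ≤ w j := fun j => by
    simp only [w]
    split_ifs <;> positivity
  have hwle : ∀ j, w j ≤ ‖E.vec j‖ ^ 2 := fun j => by
    simp only [w]
    split_ifs
    · positivity
    · exact le_rfl
  have hws : Summable w := hs.of_nonneg_of_le hw0 hwle
  have hwp : ∑' j, w j ≤ p := by
    have h₁ : HasSum (fun j => if j ∈ F then ‖E.vec j‖ ^ 2 else 0) (∑ j ∈ F, ‖E.vec j‖ ^ 2) := by
      rw [← Finset.sum_congr rfl fun j hj => if_pos hj]
      exact hasSum_sum_of_ne_finset_zero fun j hj => if_neg hj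
    have h₂ : w = fun j => ‖E.vec j‖ ^ 2 - if j ∈ F then ‖E.vec j‖ ^ 2 else 0 := by
      ext j
      simp only [w]
      split_ifs <;> simp
    rw [h₂, (E.hasSum_norm_vec_sq.sub h₁).tsum_eq]
    linarith
  have hk : ∀ k, traceNorm ((1 - Λ.starProjection) * E.op k) ≤
      ENNReal.ofReal (∑' i, w (k, i)) := fun k => by
    have hr := (E.hasRankOneSum k).mul_left (1 - Λ.starProjection)
    refine hr.traceNorm_le.trans (ENNReal.ofReal_le_ofReal ?_)
    refine hr.summable.tsum_le_tsum (fun i => ?_) (hws.prod_factor k)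
    simp only [w]
    split_ifs with hi
    · have h₁ : Λ.starProjection (E.vec (k, i)) = E.vec (k, i) :=
        Submodule.starProjection_eq_self_iff.2
          (Submodule.subset_span (Finset.mem_coe.2 (Finset.mem_image_of_mem _ hi)))
      simp [h₁]
    · rw [sq]
      gcongr
      exact ((1 - Λ.starProjection).le_opNorm _).trans
        (mul_le_of_le_one_left (norm_nonneg _) (norm_one_sub_starProjection_le Λ))
  calc ∑' k, traceNorm ((1 - Λ.starProjection) * E.op k)
      ≤ ∑' k, ENNReal.ofReal (∑' i, w (k, i)) := ENNReal.tsum_le_tsum hk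
    _ = ENNReal.ofReal (∑' k, ∑' i, w (k, i)) :=
        (ENNReal.ofReal_tsum_of_nonneg (fun k => tsum_nonneg fun i => hw0 _) hws.prod).symm
    _ = ENNReal.ofReal (∑' j, w j) := by rw [hws.tsum_prod]
    _ ≤ ENNReal.ofReal p := ENNReal.ofReal_le_ofReal hwp

theorem pDim_ne_top (E : Ensemble K H) {p : ℝ} (hp : 0 < p) : pDim E p ≠ ⊤ := by
  obtain ⟨Λ, hfd, hΛ⟩ := exists_finiteDimensional_tsum_traceNorm_le E hp
  have h : pDim E p ≤ Cardinal.toENat (Module.rank ℂ Λ) :=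
    iInf_le_of_le Λ (iInf_le_of_le inferInstance (iInf_le_of_le hΛ le_rfl))
  rw [← Module.finrank_eq_rank, Cardinal.toENat_nat] at h
  exact (h.trans_lt (ENat.natCast_lt_top _)).ne

theorem stepBound_pos (E : Ensemble K H) {ε : ℝ} (hε : 0 < ε) : 0 < stepBound E ε := by
  -- The choice `p = ε / 8` keeps the numerator positive, and `p > 0` makes the dimension finite.
  have h : ENNReal.ofReal (ε - 4 * (ε / 8)) / (pDim E (ε / 8) : ℝ≥0∞) ≤ stepBound E ε :=
    le_iSup₂_of_le (f := fun p (_ : p ∈ Set.Icc (0 : ℝ) (ε / 4)) =>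
      ENNReal.ofReal (ε - 4 * p) / (pDim E p : ℝ≥0∞)) (ε / 8)
      ⟨by positivity, by linarith⟩ le_rfl
  refine (ENNReal.div_pos ?_ ?_).trans_le h
  · exact (ENNReal.ofReal_pos.2 (by linarith)).ne'
  · simpa using pDim_ne_top E (p := ε / 8) (by positivity)

theorem exists_finrank_le_of_pDim_eq (E : Ensemble K H) {p : ℝ} {d : ℕ} (h : pDim E p = d) :
    ∃ (Λ : Submodule ℂ H) (_ : FiniteDimensional ℂ Λ),
      ∑' k, traceNorm ((1 - Λ.starProjection) * E.op k) ≤ ENNReal.ofReal p ∧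
        Module.finrank ℂ Λ ≤ d := by
  -- A strict upper bound on the infimum yields an actual subspace.
  have hlt : pDim E p < (d + 1 : ℕ) := by
    rw [h]
    exact_mod_cast Nat.lt_succ_self d
  simp only [pDim, iInf_lt_iff] at hlt
  obtain ⟨Λ, hproj, hΛ, hrank⟩ := hlt
  have hfin : Cardinal.toENat (Module.rank ℂ Λ) < ⊤ := hrank.trans (ENat.natCast_lt_top _)
  have hfd : FiniteDimensional ℂ Λ := Module.rank_lt_aleph0_iff.1 (by simpa using hfin)
  refine ⟨Λ, hfd, hΛ, ?_⟩
  rw [← Module.finrank_eq_rank, Cardinal.toENat_nat] at hrank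
  exact Nat.lt_succ_iff.1 (by exact_mod_cast hrank)

/-- If `M` is suboptimal by more than `ε`, then its violations are not all below `s_ε`. -/
theorem stepBound_le (E : Ensemble K H) {M M' : POVM K H} {a ε : ℝ} (ha0 : 0 ≤ a)
    (ha : ∀ j, violation E M j ≤ a) (hε : ε < successProb E M' - successProb E M) :
    stepBound E ε ≤ ENNReal.ofReal a := by
  refine iSup₂_le fun p hp => ?_
  rcases eq_or_ne (pDim E p) ⊤ with h | h
  · simp [h]
  obtain ⟨d, hd⟩ := ENat.ne_top_iff_exists.1 h
  obtain ⟨Λ, hfd, hΛ, hdim⟩ := exists_finrank_le_of_pDim_eq E hd.symm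
  have h₁ := successProb_sub_le E M M' hp.1 ha hΛ
  have h₂ : a * Module.finrank ℂ Λ ≤ a * d := by gcongr
  refine ENNReal.div_le_of_le_mul ?_
  rw [← hd, ENat.toENNReal_coe, ← ENNReal.ofReal_natCast, ← ENNReal.ofReal_mul ha0]
  exact ENNReal.ofReal_le_ofReal (by linarith)

theorem IsIterativeSeries.monotone {E : Ensemble K H} {M : ℕ → POVM K H}
    (hM : IsIterativeSeries E M) : Monotone fun n => successProb E (M n) :=
  monotone_nat_of_le_succ fun n => by
    obtain ⟨a, _, _, h⟩ := (hM n).exists_add_sq_le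
    linarith [sq_nonneg a]

theorem IsIterativeSeries.sub_le_successProb {E : Ensemble K H} {M : ℕ → POVM K H}
    (hM : IsIterativeSeries E M) (M' : POVM K H) {ε Δ : ℝ} (hΔ : 0 < Δ)
    (hΔs : ENNReal.ofReal Δ ≤ stepBound E ε) {n : ℕ} (hn : (Δ ^ 2)⁻¹ ≤ n) :
    successProb E M' - ε ≤ successProb E (M n) := by
  by_contra! hlt
  have hstep : ∀ m ≤ n, successProb E (M 0) + m * Δ ^ 2 ≤ successProb E (M m) := by
    intro m
    induction m with
    | zero => simp
    | succ m ih =>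
      intro hm
      obtain ⟨a, ha0, ha, h⟩ := (hM m).exists_add_sq_le
      have h₁ : successProb E (M m) ≤ successProb E (M n) := hM.monotone (by omega)
      have h₂ := stepBound_le E (M' := M') (ε := ε) ha0 ha (by linarith)
      have h₃ : Δ ≤ a := (ENNReal.ofReal_le_ofReal_iff ha0).1 (hΔs.trans h₂)
      have h₄ : Δ ^ 2 ≤ a ^ 2 := by gcongr
      have := ih (by omega)
      push_cast
      linarith
  have h₁ := hstep n le_rfl
  have h₂ : 1 ≤ n * Δ ^ 2 := by
    rwa [inv_le_iff_one_le_mul₀ (by positivity)] at hn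
  have h₃ := successProb_nonneg E (M 0)
  have h₄ := successProb_le_one E M'
  -- Otherwise every numerator in `stepBound` is nonpositive, leaving no room for `Δ > 0`.
  have hε : 0 < ε := by
    by_contra! hε
    have h₅ : stepBound E ε = 0 := by
      refine le_antisymm (iSup₂_le fun p hp => ?_) bot_le
      have : ε - 4 * p ≤ 0 := by linarith [hp.1, hp.2]
      simp [ENNReal.ofReal_of_nonpos this]
    rw [h₅] at hΔs
    exact (ENNReal.ofReal_pos.2 hΔ).not_ge hΔs
  linarith

theorem IsIterativeSeries.tendsto {E : Ensemble K H} {M : ℕ → POVM K H}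
    (hM : IsIterativeSeries E M) {Mopt : POVM K H} (hopt : IsOptimal E Mopt) :
    Tendsto (fun n => successProb E (M n)) atTop (𝓝 (successProb E Mopt)) := by
  refine tendsto_order.2 ⟨fun b hb => ?_, fun b hb =>
    Eventually.of_forall fun n => (hopt (M n)).trans_lt hb⟩
  -- Half the gap, so that `successProb E Mopt - ε` is still strictly above `b`.
  set ε := (successProb E Mopt - b) / 2 with hε
  have hε0 : 0 < ε := by rw [hε]; linarith
  obtain ⟨Δ, hΔ0, hΔ⟩ := ENNReal.lt_iff_exists_nnreal_btwn.1 (stepBound_pos E hε0)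
  have hΔ' : (0 : ℝ) < Δ := by exact_mod_cast hΔ0
  filter_upwards [eventually_ge_atTop ⌈((Δ : ℝ) ^ 2)⁻¹⌉₊] with n hn
  have := hM.sub_le_successProb Mopt hΔ' (by simpa using hΔ.le) (Nat.ceil_le.1 hn)
  linarith

end

/-! ### Existence of an optimal measurement -/

/-- The unit ball of bounded operators is compact in the weak operator topology. -/
theorem exists_weak_limit {ι : Type*} (U : Ultrafilter ι) {A : ι → H →L[ℂ] H}
    (hA : ∀ i, ‖A i‖ ≤ 1) :
    ∃ B : H →L[ℂ] H, ∀ x y, Tendsto (fun i => ⟪x, A i y⟫_ℂ) U (𝓝 ⟪x, B y⟫_ℂ) := by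
  have hbound : ∀ x y i, ‖⟪x, A i y⟫_ℂ‖ ≤ 1 * ‖x‖ * ‖y‖ := fun x y i => by
    refine (norm_inner_le_norm _ _).trans ?_
    rw [one_mul]
    gcongr
    exact ((A i).le_opNorm y).trans (mul_le_of_le_one_left (norm_nonneg _) (hA i))
  have hex : ∀ x y, ∃ z, Tendsto (fun i => ⟪x, A i y⟫_ℂ) U (𝓝 z) := fun x y => by
    -- Each matrix element stays in a compact disc, so it converges along the ultrafilter; the
    -- limits form a bounded sesquilinear form.
    obtain ⟨z, -, hz⟩ := (isCompact_closedBall (0 : ℂ) (1 * ‖x‖ * ‖y‖)).ultrafilter_le_nhds'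
      (U.map fun i => ⟪x, A i y⟫_ℂ) (by
        refine Ultrafilter.mem_map.2 (Eventually.of_forall fun i => ?_)
        simpa using hbound x y i)
    exact ⟨z, hz⟩
  choose b hb using hex
  let f : H →ₗ⋆[ℂ] H →ₗ[ℂ] ℂ := LinearMap.mk₂'ₛₗ (starRingEnd ℂ) (RingHom.id ℂ) b
    (fun x x' y => tendsto_nhds_unique (hb _ _) (by
      simpa only [inner_add_left] using (hb x y).add (hb x' y)))
    (fun c x y => tendsto_nhds_unique (hb _ _) (by
      simpa only [inner_smul_left, smul_eq_mul] using (hb x y).const_mul (starRingEnd ℂ c)))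
    (fun x y y' => tendsto_nhds_unique (hb _ _) (by
      simpa only [map_add, inner_add_right] using (hb x y).add (hb x y')))
    (fun c x y => tendsto_nhds_unique (hb _ _) (by
      simpa only [map_smul, inner_smul_right, smul_eq_mul, RingHom.id_apply] using
        (hb x y).const_mul c))
  let g : H →L⋆[ℂ] H →L[ℂ] ℂ := f.mkContinuous₂ 1 fun x y =>
    le_of_tendsto (hb x y).norm (Eventually.of_forall (hbound x y))
  refine ⟨ContinuousLinearMap.adjoint (InnerProductSpace.continuousLinearMapOfBilin g),
    fun x y => ?_⟩
  rw [ContinuousLinearMap.adjoint_inner_right,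
    InnerProductSpace.continuousLinearMapOfBilin_apply]
  exact hb x y

theorem isPositive_of_inner {T : H →L[ℂ] H}
    (h : ∀ x, (⟪x, T x⟫_ℂ).im = 0 ∧ 0 ≤ (⟪x, T x⟫_ℂ).re) : T.IsPositive := by
  rw [ContinuousLinearMap.isPositive_iff_complex]
  intro x
  rw [← inner_conj_symm (T x) x]
  constructor
  · rw [Complex.conj_eq_iff_im.2 (h x).1]
    exact Complex.ext rfl (h x).1.symm
  · exact (h x).2

theorem _root_.ContinuousLinearMap.IsPositive.im_inner_eq_zero {T : H →L[ℂ] H}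
    (hT : T.IsPositive) (x : H) : (⟪x, T x⟫_ℂ).im = 0 :=
  (Complex.nonneg_iff.1 (hT.inner_nonneg_right x)).2.symm

/-- `‖T x‖² ≤ ⟪x, T x⟫` for `0 ≤ T ≤ 1`. -/
theorem norm_apply_sq_le {T : H →L[ℂ] H} (hT : T.IsPositive)
    (h1 : ∀ x, (⟪x, T x⟫_ℂ).re ≤ ‖x‖ ^ 2) (x : H) : ‖T x‖ ^ 2 ≤ (⟪x, T x⟫_ℂ).re := by
  have hT0 := (ContinuousLinearMap.nonneg_iff_isPositive T).2 hT
  have hS : ∀ y, ‖CFC.sqrt T y‖ ^ 2 = (⟪y, T y⟫_ℂ).re := norm_sqrt_apply_sq hT0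
  have hSS : T x = CFC.sqrt T (CFC.sqrt T x) := by
    rw [← mul_apply_eq_comp, CFC.sqrt_mul_sqrt_self T]
  have h : ‖CFC.sqrt T (CFC.sqrt T x)‖ ^ 2 ≤ ‖CFC.sqrt T x‖ ^ 2 := by
    rw [hS]
    exact h1 _
  rwa [← hSS, hS] at h

/-- A family of positive operators whose finite sums are at most one extends to a measurement. -/
theorem exists_povm_ge {N : K → H →L[ℂ] H} (hN : ∀ k, (N k).IsPositive)
    (hle : ∀ (F : Finset K) x, ∑ k ∈ F, (⟪x, N k x⟫_ℂ).re ≤ ‖x‖ ^ 2) (k₀ : K) :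
    ∃ M : POVM K H, ∀ k x, (⟪x, N k x⟫_ℂ).re ≤ (⟪x, M.op k x⟫_ℂ).re := by
  classical
  have hre : ∀ (F : Finset K) x,
      (⟪x, (∑ k ∈ F, N k) x⟫_ℂ).re = ∑ k ∈ F, (⟪x, N k x⟫_ℂ).re := fun F x => by
    rw [sum_apply, inner_sum, Complex.re_sum]
  have hnorm : ∀ (F : Finset K) x, ‖∑ k ∈ F, N k x‖ ^ 2 ≤ ∑ k ∈ F, (⟪x, N k x⟫_ℂ).re := by
    intro F x
    have h := norm_apply_sq_le (ContinuousLinearMap.isPositive_sum F fun k _ => hN k)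
      (fun y => (hre F y).trans_le (hle F y)) x
    rwa [hre, sum_apply] at h
  have hr0 : ∀ k x, 0 ≤ (⟪x, N k x⟫_ℂ).re := fun k x => (hN k).re_inner_nonneg_right x
  have hrs : ∀ x, Summable fun k => (⟪x, N k x⟫_ℂ).re := fun x =>
    summable_of_sum_le (fun k => hr0 k x) fun F => hle F x
  have hs : ∀ x, Summable fun k => N k x := fun x => by
    rw [summable_iff_vanishing_norm]
    intro ε hε
    obtain ⟨s, h⟩ := summable_iff_vanishing_norm.1 (hrs x) (ε ^ 2) (by positivity)
    refine ⟨s, fun t ht => ?_⟩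
    -- Partial sums are positive contractions, so the squared norm of a block is at most its
    -- quadratic form: weak summability implies strong.
    have h₁ := (hnorm t x).trans_lt ((le_abs_self _).trans_lt (h t ht))
    exact lt_of_pow_lt_pow_left₀ 2 hε.le h₁
  let L₀ : H →ₗ[ℂ] H :=
    { toFun := fun x => ∑' k, N k x
      map_add' := fun x y => by
        simp only [map_add]
        exact (hs x).tsum_add (hs y)
      map_smul' := fun c x => by
        simp only [map_smul, RingHom.id_apply]
        exact (hs x).tsum_const_smul c }
  let L : H →L[ℂ] H := L₀.mkContinuous 1 fun x => by
    refine le_of_tendsto (hs x).hasSum.norm (Eventually.of_forall fun F => ?_)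
    rw [one_mul]
    exact (sq_le_sq₀ (norm_nonneg _) (norm_nonneg _)).1 ((hnorm F x).trans (hle F x))
  have hL : ∀ x, HasSum (fun k => N k x) (L x) := fun x => (hs x).hasSum
  have hD : (1 - L).IsPositive := by
    refine isPositive_of_inner fun x => ?_
    have h₁ : HasSum (fun k => ⟪x, N k x⟫_ℂ) ⟪x, L x⟫_ℂ := (hL x).mapL (innerSL ℂ x)
    have h₂ : (⟪x, L x⟫_ℂ).im = 0 := by
      have := Complex.hasSum_im h₁
      simp only [(hN _).im_inner_eq_zero] at this
      exact this.unique hasSum_zero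
    have h₃ : (⟪x, L x⟫_ℂ).re ≤ ‖x‖ ^ 2 :=
      hasSum_le_of_sum_le (Complex.hasSum_re h₁) fun F => hle F x
    have h₄ : ⟪x, (1 - L) x⟫_ℂ = ((‖x‖ ^ 2 : ℝ) : ℂ) - ⟪x, L x⟫_ℂ := by
      rw [sub_apply, one_apply_eq_self, inner_sub_right, inner_self_eq_norm_sq_to_K]
      push_cast
      rfl
    rw [h₄, Complex.sub_im, Complex.sub_re, Complex.ofReal_re, Complex.ofReal_im, h₂]
    exact ⟨sub_zero 0, sub_nonneg.2 h₃⟩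
  have hpos : ∀ k, (if k = k₀ then 1 - L else 0 : H →L[ℂ] H).IsPositive := fun k => by
    split_ifs
    · exact hD
    · exact ContinuousLinearMap.isPositive_zero
  refine ⟨⟨fun k => N k + if k = k₀ then 1 - L else 0, fun k => (hN k).add (hpos k),
    fun x => ?_⟩, fun k x => ?_⟩
  · have h := (hL x).add (hasSum_ite_eq k₀ ((1 - L) x))
    have e : L x + (1 - L) x = x := by simp
    rw [e] at h
    convert h using 2 with k
    rw [add_apply]
    split_ifs
    · rfl
    · rw [zero_apply]
  · rw [add_apply, inner_add_right, Complex.add_re]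
    exact le_add_of_nonneg_right ((hpos k).re_inner_nonneg_right x)

/-- Weak limits of a maximizing sequence are positive with finite sums at most one. Completing them
to a POVM can only increase the success probability. -/
theorem exists_isOptimal (E : Ensemble K H) (M₀ : POVM K H) : ∃ M : POVM K H, IsOptimal E M := by
  have hbdd : BddAbove (Set.range (successProb E)) :=
    ⟨1, Set.forall_mem_range.2 fun M => successProb_le_one E M⟩
  obtain ⟨u, -, hu, hmem⟩ := exists_seq_tendsto_sSup (⟨_, M₀, rfl⟩ :
    (Set.range (successProb E)).Nonempty) hbdd
  choose M hM using hmem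
  let U : Ultrafilter ℕ := hyperfilter ℕ
  have hU : (U : Filter ℕ) ≤ atTop := Nat.hyperfilter_le_atTop
  have hlim := fun k => exists_weak_limit U (A := fun n => (M n).op k)
    fun n => (M n).norm_op_le_one k
  choose N hN using hlim
  have hNre : ∀ k x, Tendsto (fun n => (⟪x, (M n).op k x⟫_ℂ).re) U (𝓝 (⟪x, N k x⟫_ℂ).re) :=
    fun k x => (Complex.continuous_re.tendsto _).comp (hN k x x)
  have hNpos : ∀ k, (N k).IsPositive := fun k => isPositive_of_inner fun x => by
    constructor
    · have h := (Complex.continuous_im.tendsto _).comp (hN k x x)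
      simp only [Function.comp_def, ((M _).isPositive k).im_inner_eq_zero] at h
      exact tendsto_nhds_unique h tendsto_const_nhds
    · exact ge_of_tendsto' (hNre k x) fun n => ((M n).isPositive k).re_inner_nonneg_right x
  have hNle : ∀ (F : Finset K) x, ∑ k ∈ F, (⟪x, N k x⟫_ℂ).re ≤ ‖x‖ ^ 2 := fun F x =>
    le_of_tendsto' (tendsto_finsetSum F fun k _ => hNre k x) fun n =>
      sum_le_hasSum F (fun k _ => ((M n).isPositive k).re_inner_nonneg_right x)
        ((M n).hasSum_re_inner x)
  obtain ⟨Mopt, hge⟩ := exists_povm_ge hNpos hNle E.nonempty.some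
  have hdom : ∀ n j, ‖(⟪E.vec j, (M n).op j.1 (E.vec j)⟫_ℂ).re‖ ≤ ‖E.vec j‖ ^ 2 := fun n j => by
    refine (Complex.abs_re_le_norm _).trans ((norm_inner_le_norm _ _).trans ?_)
    rw [sq]
    gcongr
    exact norm_op_vec_le E (M n) j
  -- Weak convergence acts termwise; the summable majorant `‖E.vec j‖²` is independent of the POVM.
  have hconv := tendsto_tsum_of_dominated_convergence E.hasSum_norm_vec_sq.summable
    (fun j => hNre j.1 (E.vec j)) (Eventually.of_forall hdom)
  simp only [(hasSum_successProb E (M _)).tsum_eq, hM] at hconv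
  have hsup := tendsto_nhds_unique hconv (hu.mono_left hU)
  refine ⟨Mopt, fun M' => (le_csSup hbdd ⟨M', rfl⟩).trans ?_⟩
  rw [← hsup, ← (hasSum_successProb E Mopt).tsum_eq]
  refine Summable.tsum_le_tsum (fun j => hge j.1 (E.vec j)) ?_
    (hasSum_successProb E Mopt).summable
  exact (hasSum_successProb E Mopt).summable.of_nonneg_of_le
    (fun j => (hNpos j.1).re_inner_nonneg_right (E.vec j)) fun j => hge j.1 (E.vec j)

end QuantumDetection

theorem theorem4 {K H : Type*} [NormedAddCommGroup H] [InnerProductSpace ℂ H] [CompleteSpace H]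
    (E : Ensemble K H) (M₀ : POVM K H) :
    (∃ Mopt : POVM K H, IsOptimal E Mopt) ∧
    (∃ M : ℕ → POVM K H, M 0 = M₀ ∧ IsIterativeSeries E M) ∧
    ∀ M : ℕ → POVM K H, M 0 = M₀ → IsIterativeSeries E M →
      ∀ Mopt : POVM K H, IsOptimal E Mopt →
        Tendsto (fun n => successProb E (M n)) atTop (𝓝 (successProb E Mopt)) ∧
        ∀ ε : ℝ, 0 < ε → 0 < stepBound E ε ∧
          ∀ Δ : ℝ, 0 < Δ → ENNReal.ofReal Δ ≤ stepBound E ε →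
            ∀ n : ℕ, (Δ ^ 2)⁻¹ ≤ (n : ℝ) →
              successProb E Mopt - ε ≤ successProb E (M n) :=
  ⟨exists_isOptimal E M₀, exists_isIterativeSeries E M₀, fun _ _ hM Mopt hopt =>
    ⟨hM.tendsto hopt, fun _ hε => ⟨stepBound_pos E hε, fun _ hΔ hΔs _ hn =>
      hM.sub_le_successProb Mopt hΔ hΔs hn⟩⟩⟩
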